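/- Let $P$ and $M$ be connected paracompact (Hausdorff, finite-dimensional) smooth manifolds, and let $p:P\to M$ be a smooth principal bundle with structure group a Lie group $G$ acting smoothly from the left on $P$. Let $\omega$ be a flat connection on $P(M,G)$, that is, a connection such that every point of $M$ has an open neighbourhood $U$ over which $(P,\omega)$ is isomorphic to the product bundle $G\times U$ with its canonical flat connection (the one whose horizontal leaves are the slices $\{a\}\times U$). Let $q:\widehat M\to M$ be a regular covering manifold ($\widehat M$ connected, $q$ a smooth covering map, $q_\#\pi_1(\widehat M)$ normal in $\pi_1(M)$). Let $\widehat P=\{(n,x)\in\widehat M\times P : q(n)=p(x)\}$ be the induced principal $G$-bundle over $\widehat M$, with canonical map $\widehat q:\widehat P\to P$, $\widehat q(n,x)=x$, and let $\widehat\omega=\widehat q^{\,*}\omega$ be the induced connection. Fix $n_0\in\widehat M$ and $x_0\in P$ with $p(x_0)=q(n_0)$. Let $h_\omega:\pi_1(M,q(n_0))\to G$ be the holonomy homomorphism of $\omega$ with respect to $x_0$: $h_\omega([w])=g$ if and only if some piecewise smooth loop in the class $[w]$ has a horizontal lift starting at $x_0$ and ending at $g x_0$. (For the product in $\pi_1$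 given by $[w][w']=$ first $w$, then $w'$, this is a well-defined homomorphism.) Then $\widehat\omega$ is trivial, i.e. $(\widehat P,\widehat\omega)$ is isomorphic, as a principal $G$-bundle with connection over $\widehat M$, to the product bundle $G\times\widehat M$ with its canonical flat connection, if and only if $$q_\#\big(\pi_1(\widehat M,n_0)\big)\subseteq\ker h_\omega .$$ -/

import Mathlib

open Set Topology Manifold
open scoped ContDiff

noncomputable section

namespace FlatBundle

section Definitions

variable (EG EP EM : Type*)
  [NormedAddCommGroup EG] [NormedSpace ℝ EG]
  [NormedAddCommGroup EP] [NormedSpace ℝ EP]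
  [NormedAddCommGroup EM] [NormedSpace ℝ EM]
  (G : Type*) [TopologicalSpace G] [ChartedSpace EG G] [Group G]
  {P : Type*} [TopologicalSpace P] [ChartedSpace EP P] [MulAction G P]
  {M : Type*} [TopologicalSpace M] [ChartedSpace EM M]
  {N : Type*} [TopologicalSpace N] [ChartedSpace EM N]

/-! ### Principal bundles -/

/-- `Φ` is a trivialization over `U` of the bundle `p : P → M` with left `G`-action: a
diffeomorphism `G × U ≃ p ⁻¹ U` over `U` which is equivariant for the left translation action
`g (a, m) = (g a, m)` on the product. -/
structure IsTrivialization (p : P → M) (U : Set M)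
    (Φ : PartialDiffeomorph (𝓘(ℝ, EG).prod 𝓘(ℝ, EM)) 𝓘(ℝ, EP) (G × M) P ∞) : Prop where
  source_eq : Φ.source = univ ×ˢ U
  target_eq : Φ.target = p ⁻¹' U
  proj_apply : ∀ (a : G), ∀ m ∈ U, p (Φ (a, m)) = m
  equivariant : ∀ (g a : G), ∀ m ∈ U, Φ (g * a, m) = g • Φ (a, m)

/-- `p : P → M` is a smooth principal bundle whose structure group `G` acts smoothly from the left
on the total space `P`. (The action is then free, with the fibres of `p` as its orbits.) -/
structure IsPrincipalBundle (p : P → M) : Prop where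
  contMDiff_smul : ContMDiff (𝓘(ℝ, EG).prod 𝓘(ℝ, EP)) 𝓘(ℝ, EP) ∞ (fun z : G × P => z.1 • z.2)
  contMDiff_proj : ContMDiff 𝓘(ℝ, EP) 𝓘(ℝ, EM) ∞ p
  proj_smul : ∀ (g : G) (x : P), p (g • x) = p x
  locallyTrivial : ∀ m : M, ∃ U : Set M, IsOpen U ∧ m ∈ U ∧
    ∃ Φ : PartialDiffeomorph (𝓘(ℝ, EG).prod 𝓘(ℝ, EM)) 𝓘(ℝ, EP) (G × M) P ∞,
      IsTrivialization EG EP EM G p U Φ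

/-! ### Connections -/

/-- The adjoint representation, `Ad g` being the derivative at `1` of `a ↦ g a g⁻¹`. -/
def Ad (g : G) : GroupLieAlgebra 𝓘(ℝ, EG) G →L[ℝ] GroupLieAlgebra 𝓘(ℝ, EG) G :=
  mfderiv 𝓘(ℝ, EG) 𝓘(ℝ, EG) (fun a : G => g * a * g⁻¹) 1

variable (P) in
/-- `1`-forms on `P` with values in the Lie algebra of `G` (no regularity is imposed here). -/
abbrev LieForm : Type _ :=
  ∀ x : P, TangentSpace 𝓘(ℝ, EP) x →L[ℝ] GroupLieAlgebra 𝓘(ℝ, EG) G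

/-- `θ` is a connection form on the principal bundle `P`: it is smooth, it reproduces the generator
`A` of each fundamental vector field `x ↦ d/dt (exp (t A) x)`, and `(L_g)^* θ = Ad g ∘ θ`. -/
structure IsConnectionForm [IsManifold 𝓘(ℝ, EP) ∞ P] (θ : LieForm EG EP G P) : Prop where
  smooth : ContMDiff (M' := EG) 𝓘(ℝ, EP).tangent 𝓘(ℝ, EG) ∞
    (fun v : TangentBundle 𝓘(ℝ, EP) P => (θ v.proj v.snd : EG))
  fundamental : ∀ (x : P) (A : GroupLieAlgebra 𝓘(ℝ, EG) G),
    θ ((1 : G) • x) (mfderiv 𝓘(ℝ, EG) 𝓘(ℝ, EP) (fun g : G => g • x) 1 A) = A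
  equivariant : ∀ (g : G) (x : P) (v : TangentSpace 𝓘(ℝ, EP) x),
    θ (g • x) (mfderiv 𝓘(ℝ, EP) 𝓘(ℝ, EP) (fun y : P => g • y) x v) = Ad EG G g (θ x v)

variable (M) in
/-- The connection form of the canonical flat connection of the product bundle `G × M`, whose
horizontal leaves are the slices `{a} × M`. At `(a, m)` it is the derivative of
`(b, m') ↦ b a⁻¹`, that is, the pullback of the right-invariant Maurer–Cartan form of `G`. -/
def canonicalFlatForm (z : G × M) :
    TangentSpace (𝓘(ℝ, EG).prod 𝓘(ℝ, EM)) z →L[ℝ] GroupLieAlgebra 𝓘(ℝ, EG) G :=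
  mfderiv (𝓘(ℝ, EG).prod 𝓘(ℝ, EM)) 𝓘(ℝ, EG) (fun y : G × M => y.1 * z.1⁻¹) z

/-- Over `U`, the bundle `p` with the connection `θ` is isomorphic to the product bundle `G × U`
with its canonical flat connection. -/
def IsTrivialOver (p : P → M) (θ : LieForm EG EP G P) (U : Set M) : Prop :=
  ∃ Φ : PartialDiffeomorph (𝓘(ℝ, EG).prod 𝓘(ℝ, EM)) 𝓘(ℝ, EP) (G × M) P ∞,
    IsTrivialization EG EP EM G p U Φ ∧
    ∀ (a : G), ∀ m ∈ U, ∀ v : TangentSpace (𝓘(ℝ, EG).prod 𝓘(ℝ, EM)) (a, m),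
      θ (Φ (a, m)) (mfderiv (𝓘(ℝ, EG).prod 𝓘(ℝ, EM)) 𝓘(ℝ, EP) Φ (a, m) v)
        = canonicalFlatForm EG EM G M (a, m) v

/-- The connection `θ` is trivial: it is isomorphic to the canonical flat connection of the product
bundle. -/
def IsTrivialConnection (p : P → M) (θ : LieForm EG EP G P) : Prop :=
  IsTrivialOver EG EP EM G p θ univ

/-- The connection `θ` is flat: every point of the base has an open neighbourhood over which it is
isomorphic to the canonical flat connection of the product bundle. -/
def IsFlat (p : P → M) (θ : LieForm EG EP G P) : Prop :=
  ∀ m : M, ∃ U : Set M, IsOpen U ∧ m ∈ U ∧ IsTrivialOver EG EP EM G p θ U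

/-! ### Holonomy -/

variable {EG EP G} in
/-- A piecewise smooth path in `P` whose velocity is annihilated by `θ`. -/
def IsHorizontal (θ : LieForm EG EP G P) {x y : P} (c : Path x y) : Prop :=
  ∃ (k : ℕ) (t : ℕ → ℝ), Monotone t ∧ t 0 = 0 ∧ t k = 1 ∧ ∀ i < k,
    ContMDiffOn 𝓘(ℝ, ℝ) 𝓘(ℝ, EP) ∞ c.extend (Icc (t i) (t (i + 1))) ∧
    ∀ s ∈ Ioo (t i) (t (i + 1)),
      θ (c.extend s) (mfderiv 𝓘(ℝ, ℝ) 𝓘(ℝ, EP) c.extend s (1 : ℝ)) = 0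

variable {EG EP G} in
/-- Some loop `w` in the class `γ ∈ π₁(M, m)` has a horizontal lift starting at `x₀` and ending
at `g x₀`. -/
def HasHolonomy (p : P → M) (θ : LieForm EG EP G P) {m : M} (x₀ : P)
    (γ : FundamentalGroup M m) (g : G) : Prop :=
  ∃ w : Path m m, FundamentalGroup.fromPath (Path.Homotopic.Quotient.mk w) = γ ∧
    ∃ c : Path x₀ (g • x₀), IsHorizontal θ c ∧ ∀ s, p (c s) = w s

variable {EG EP G} in
/-- `h : π₁(M, m) → G` is the holonomy homomorphism with respect to the point `x₀` of the fibre
over `m`: `h [w] = g` precisely when the horizontal lifts from `x₀` of the piecewise smooth loops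
in the class `[w]` end at `g x₀`. As `G` acts from the left, `π₁` carries the concatenation product
`[w] [w'] = [first w, then w']`, which is opposite to the multiplication of Mathlib's
`FundamentalGroup`. -/
def IsHolonomyHom (p : P → M) (θ : LieForm EG EP G P) {m : M} (x₀ : P)
    (h : (FundamentalGroup M m)ᵐᵒᵖ →* G) : Prop :=
  ∀ (γ : FundamentalGroup M m) (g : G), HasHolonomy p θ x₀ γ g ↔ h (MulOpposite.op γ) = g

/-! ### Coverings and induced bundles -/

/-- `q : N → M` is a regular covering manifold: a covering map which is a local diffeomorphism and
for which the image of `π₁(N)` is a normal subgroup of `π₁(M)`. -/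
structure IsRegularCovering (q : C(N, M)) : Prop where
  isCoveringMap : IsCoveringMap q
  isLocalDiffeomorph : IsLocalDiffeomorph 𝓘(ℝ, EM) 𝓘(ℝ, EM) ∞ q
  normal : ∀ n : N, (FundamentalGroup.map q n).range.Normal

variable {EG EP EM G}
variable {p : P → M} {q : C(N, M)}

/-- The total space `{(n, x) ∈ N × P | q n = p x}` of the bundle over `N` induced by `q`, with its
projection `proj` onto `N` and its canonical bundle map `toTotal` to `P`. -/
@[ext]
structure InducedBundle (hp : IsPrincipalBundle EG EP EM G p) (hq : IsRegularCovering EM q) where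
  proj : N
  toTotal : P
  comm : q proj = p toTotal

namespace InducedBundle

variable (hp : IsPrincipalBundle EG EP EM G p) (hq : IsRegularCovering EM q)

variable {hp hq} in
/-- The inclusion of the total space into `N × P`. -/
def toProd (z : InducedBundle hp hq) : N × P := (z.proj, z.toTotal)

/-- The total space carries the topology induced from `N × P`. -/
instance : TopologicalSpace (InducedBundle hp hq) := .induced toProd inferInstance

theorem continuous_toProd : Continuous (toProd : InducedBundle hp hq → N × P) :=
  continuous_induced_dom

/-- `G` acts on the induced bundle through the second component. -/
instance : MulAction G (InducedBundle hp hq) where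
  smul g z := ⟨z.proj, g • z.toTotal, by rw [hp.proj_smul]; exact z.comm⟩
  one_smul z := InducedBundle.ext rfl (one_smul G z.toTotal)
  mul_smul g g' z := InducedBundle.ext rfl (mul_smul g g' z.toTotal)

/-- The canonical bundle map is a local homeomorphism. -/
theorem isLocalHomeomorph_toTotal :
    IsLocalHomeomorph (toTotal : InducedBundle hp hq → P) := by
  classical
  intro z
  obtain ⟨e, hz, he⟩ := hq.isCoveringMap.isLocalHomeomorph z.proj
  have hpc : Continuous p := hp.contMDiff_proj.continuous
  have h1 : ∀ x, p x ∈ e.target → q (e.symm (p x)) = p x := fun x hx => by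
    rw [he]; exact e.right_inv hx
  have h2 : ∀ y : InducedBundle hp hq, e y.proj = p y.toTotal := fun y => by
    rw [← he]; exact y.comm
  have h3 : ∀ y : InducedBundle hp hq, y.proj ∈ e.source → p y.toTotal ∈ e.target :=
    fun y hy => by rw [← h2]; exact e.map_source hy
  let inv : P → InducedBundle hp hq := fun x =>
    if h : p x ∈ e.target then ⟨e.symm (p x), x, h1 x h⟩ else z
  have hinv : ∀ x (hx : p x ∈ e.target), inv x = ⟨e.symm (p x), x, h1 x hx⟩ :=
    fun x hx => dif_pos hx
  refine ⟨
    { toFun := toTotal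
      invFun := inv
      source := {y | y.proj ∈ e.source}
      target := p ⁻¹' e.target
      map_source' := fun y hy => h3 y hy
      map_target' := fun x hx => ?_
      left_inv' := fun y hy => ?_
      right_inv' := fun x hx => ?_
      open_source := e.open_source.preimage (continuous_fst.comp (continuous_toProd hp hq))
      open_target := e.open_target.preimage hpc
      continuousOn_toFun := (continuous_snd.comp (continuous_toProd hp hq)).continuousOn
      continuousOn_invFun := ?_ }, hz, rfl⟩
  · change (inv x).proj ∈ e.source
    rw [hinv x hx]; exact e.map_target hx
  · rw [hinv _ (h3 y hy)]
    refine InducedBundle.ext ?_ rfl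
    change e.symm (p y.toTotal) = y.proj
    rw [← h2]; exact e.left_inv hy
  · rw [hinv x hx]
  · have hind : IsInducing (toProd : InducedBundle hp hq → N × P) := ⟨rfl⟩
    rw [hind.continuousOn_iff]
    refine ContinuousOn.congr (f := fun x => (e.symm (p x), x)) ?_
      (fun x hx => by simp only [Function.comp, hinv x hx, toProd])
    exact (e.continuousOn_symm.comp hpc.continuousOn (fun x hx => hx)).prodMk continuousOn_id

/-- The smooth structure of the induced bundle: the charts are the charts of `P` composed with the
local homeomorphisms onto open subsets of `P` given by the covering map `toTotal`. -/
instance : ChartedSpace EP (InducedBundle hp hq) where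
  atlas := {φ | ∃ e : OpenPartialHomeomorph (InducedBundle hp hq) P,
    (toTotal : InducedBundle hp hq → P) = e ∧
      ∃ c ∈ atlas EP P, φ = e.trans c}
  chartAt z := (isLocalHomeomorph_toTotal hp hq z).choose.trans (chartAt EP z.toTotal)
  mem_chart_source z := by
    have h := (isLocalHomeomorph_toTotal hp hq z).choose_spec
    rw [OpenPartialHomeomorph.trans_source]
    refine ⟨h.1, ?_⟩
    rw [mem_preimage, ← h.2]
    exact mem_chart_source EP _
  chart_mem_atlas z := ⟨_, (isLocalHomeomorph_toTotal hp hq z).choose_spec.2, _,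
    chart_mem_atlas EP _, rfl⟩

instance [IsManifold 𝓘(ℝ, EP) ∞ P] : IsManifold 𝓘(ℝ, EP) ∞ (InducedBundle hp hq) := by
  refine isManifold_of_contDiffOn _ _ _ ?_
  rintro _ _ ⟨e, he, c, hc, rfl⟩ ⟨e', he', c', hc', rfl⟩
  have h := (contDiffGroupoid ∞ 𝓘(ℝ, EP)).compatible hc hc'
  rw [contDiffGroupoid, mem_groupoid_of_pregroupoid] at h
  have key : ∀ y ∈ (e.trans c).target, e' (e.symm (c.symm y)) = c.symm y := by
    intro y hy
    rw [OpenPartialHomeomorph.trans_target] at hy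
    rw [← he', he]
    exact e.right_inv hy.2
  refine (h.1.mono ?_).congr ?_
  · rintro y ⟨hy, hy'⟩
    refine ⟨?_, hy'⟩
    have hk := key y (by simpa using hy.1)
    have h1 := hy.1
    have h2 := hy.2
    simp only [mfld_simps] at h1 h2 hk ⊢
    rw [hk] at h2
    exact ⟨h1.1, h2.2⟩
  · rintro y ⟨hy, hy'⟩
    have hk := key y (by simpa using hy.1)
    simp only [mfld_simps] at hk ⊢
    rw [hk]

/-- The induced connection, the pullback of `θ` under the canonical bundle map. -/
def inducedForm (θ : LieForm EG EP G P) : LieForm EG EP G (InducedBundle hp hq) :=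
  fun z => (θ z.toTotal).comp
    (mfderiv 𝓘(ℝ, EP) 𝓘(ℝ, EP) toTotal z)

end InducedBundle

end Definitions

end FlatBundle

end

/-! A flat bundle is a covering in disguise. Flat trivializations differ by locally constant
functions, so the slices `{a} × U` glue to a finer topology on `P`, the leaf topology. With it
(`LeafSpace`) the projection to `M` is a covering on which `G` acts freely with the fibres as
orbits: `LeafSpace.isQuotientCoveringMap`.

Horizontal paths are continuous for the leaf topology, and every path in a leaf is homotopic there
to a horizontal one. Hence holonomy is the monodromy of this covering: `hasHolonomy_iff`.

A trivialization of the induced connection gives horizontal global sections, and such a section is a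
lift of `q` to the leaf space. Conversely, the `G`-translates of one lift fill the induced bundle
and trivialize it: `IsTrivialConnection.exists_lift` and `isTrivialConnection_of_lift`.

The lifting criterion for coverings then decides the matter: a lift exists iff the image of `π₁(N)`
lies in that of `π₁` of the leaf space, which is the kernel of the monodromy:
`exists_lift_iff_range_le_ker`. -/

namespace FlatBundle

/-! ### Maps with vanishing derivative -/

section LocallyConstant

variable {EG EX : Type*}
  [NormedAddCommGroup EG] [NormedSpace ℝ EG] [NormedAddCommGroup EX] [NormedSpace ℝ EX]
  {G : Type*} [TopologicalSpace G] [ChartedSpace EG G]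
  {X : Type*} [TopologicalSpace X] [ChartedSpace EX X]

/-- Read in charts, `f` has zero derivative on a ball, which is convex, so it is constant there; the
chart of `G` is injective on its source. -/
theorem eventually_eq_of_mfderiv_eq_zero [IsManifold 𝓘(ℝ, EG) 1 G] [IsManifold 𝓘(ℝ, EX) 1 X]
    {f : X → G} {x : X}
    (h : ∀ᶠ y in 𝓝 x, MDifferentiableAt 𝓘(ℝ, EX) 𝓘(ℝ, EG) f y ∧
      mfderiv 𝓘(ℝ, EX) 𝓘(ℝ, EG) f y = 0) :
    ∀ᶠ y in 𝓝 x, f y = f x := by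
  set φ := extChartAt 𝓘(ℝ, EG) (f x)
  set χ := extChartAt 𝓘(ℝ, EX) x
  have hf : ContinuousAt f x := h.self_of_nhds.1.continuousAt
  have hsrc : ∀ᶠ y in 𝓝 x, f y ∈ φ.source := hf (extChartAt_source_mem_nhds _)
  have hχ : ContinuousAt χ.symm (χ x) := continuousAt_extChartAt_symm x
  have hχx : χ.symm (χ x) = x := extChartAt_to_inv x
  have key : ∀ᶠ e in 𝓝 (χ x), e ∈ χ.target ∧ f (χ.symm e) ∈ φ.source ∧
      HasFDerivAt (fun e => φ (f (χ.symm e))) (0 : EX →L[ℝ] EG) e := by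
    rw [ContinuousAt, hχx] at hχ
    filter_upwards [hχ.eventually h, hχ.eventually hsrc, extChartAt_target_mem_nhds x]
      with e he hes het
    refine ⟨het, hes, ?_⟩
    have h1 : MDifferentiableAt 𝓘(ℝ, EX) 𝓘(ℝ, EX) χ.symm e :=
      (mdifferentiableOn_extChartAt_symm (I := 𝓘(ℝ, EX)) (x := x) e het).mdifferentiableAt
        (extChartAt_target_mem_nhds' het)
    have h2 : MDifferentiableAt 𝓘(ℝ, EG) 𝓘(ℝ, EG) φ (f (χ.symm e)) :=
      mdifferentiableAt_extChartAt (by simpa [φ] using hes)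
    have h3 := h2.hasMFDerivAt.comp e (he.1.hasMFDerivAt.comp e h1.hasMFDerivAt)
    rw [he.2] at h3
    have h4 := h3.hasFDerivAt
    rw [ContinuousLinearMap.zero_comp, ContinuousLinearMap.comp_zero] at h4
    exact h4
  obtain ⟨r, hr, hball⟩ := Metric.eventually_nhds_iff_ball.1 key
  have hx : χ x ∈ Metric.ball (χ x) r := Metric.mem_ball_self hr
  have hcx : ContinuousAt χ x := continuousAt_extChartAt x
  filter_upwards [hcx (Metric.ball_mem_nhds _ hr), extChartAt_source_mem_nhds (I := 𝓘(ℝ, EX)) x]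
    with y hy hys
  have := (convex_ball (χ x) r).is_const_of_fderivWithin_eq_zero (𝕜 := ℝ)
    (f := fun e => φ (f (χ.symm e)))
    (fun e he => (hball e he).2.2.differentiableAt.differentiableWithinAt)
    (fun e he => by
      rw [fderivWithin_of_isOpen Metric.isOpen_ball he, (hball e he).2.2.fderiv]) hy hx
  have h1 := φ.injOn (hball _ hy).2.1 (hball _ hx).2.1 this
  rwa [hχx, χ.left_inv hys] at h1

end LocallyConstant

/-! ### Flat trivializations and horizontal maps -/

section FlatTrivialization

variable {EG EP EM EX : Type*}
  [NormedAddCommGroup EG] [NormedSpace ℝ EG]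
  [NormedAddCommGroup EP] [NormedSpace ℝ EP]
  [NormedAddCommGroup EM] [NormedSpace ℝ EM]
  [NormedAddCommGroup EX] [NormedSpace ℝ EX]
  {G : Type*} [TopologicalSpace G] [ChartedSpace EG G] [Group G]
  {P : Type*} [TopologicalSpace P] [ChartedSpace EP P] [MulAction G P]
  {M : Type*} [TopologicalSpace M] [ChartedSpace EM M]
  {X : Type*} [TopologicalSpace X] [ChartedSpace EX X]

/-- A local trivialization over `U` which identifies the connection `θ` with the canonical flat
connection of `G × U`. -/
structure IsFlatTrivialization (p : P → M) (θ : LieForm EG EP G P) (U : Set M)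
    (Φ : PartialDiffeomorph (𝓘(ℝ, EG).prod 𝓘(ℝ, EM)) 𝓘(ℝ, EP) (G × M) P ∞) : Prop
    extends IsTrivialization EG EP EM G p U Φ where
  form_apply : ∀ (a : G), ∀ m ∈ U, ∀ v : TangentSpace (𝓘(ℝ, EG).prod 𝓘(ℝ, EM)) (a, m),
      θ (Φ (a, m)) (mfderiv (𝓘(ℝ, EG).prod 𝓘(ℝ, EM)) 𝓘(ℝ, EP) Φ (a, m) v)
        = canonicalFlatForm EG EM G M (a, m) v

namespace IsTrivialization

variable {p : P → M} {U : Set M}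
  {Φ : PartialDiffeomorph (𝓘(ℝ, EG).prod 𝓘(ℝ, EM)) 𝓘(ℝ, EP) (G × M) P ∞}

theorem isOpen (hΦ : IsTrivialization EG EP EM G p U Φ) : IsOpen U := by
  have := Φ.open_source.preimage
    (Continuous.prodMk_right (1 : G) : Continuous fun m : M => ((1 : G), m))
  simpa [hΦ.source_eq] using this

theorem mem_source (hΦ : IsTrivialization EG EP EM G p U Φ) (a : G) {m : M} (hm : m ∈ U) :
    (a, m) ∈ Φ.source := by
  rw [hΦ.source_eq]; exact ⟨mem_univ _, hm⟩

theorem mem_target (hΦ : IsTrivialization EG EP EM G p U Φ) {x : P} (hx : p x ∈ U) :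
    x ∈ Φ.target := by
  rw [hΦ.target_eq]; exact hx

/-- The `G`-coordinate of a point of `p ⁻¹ U`. -/
noncomputable def coord (_ : IsTrivialization EG EP EM G p U Φ) (x : P) : G := (Φ.symm x).1

theorem symm_apply (hΦ : IsTrivialization EG EP EM G p U Φ) {x : P} (hx : p x ∈ U) :
    Φ.symm x = (hΦ.coord x, p x) := by
  have h1 := Φ.map_target (hΦ.mem_target hx)
  rw [hΦ.source_eq] at h1
  have h2 := hΦ.proj_apply (hΦ.coord x) _ h1.2
  have h3 : Φ (Φ.symm x) = x := Φ.right_inv (hΦ.mem_target hx)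
  refine Prod.ext rfl ?_
  change p (Φ (Φ.symm x)) = (Φ.symm x).2 at h2
  rw [← h2, h3]

theorem apply_coord (hΦ : IsTrivialization EG EP EM G p U Φ) {x : P} (hx : p x ∈ U) :
    Φ (hΦ.coord x, p x) = x := by
  rw [← hΦ.symm_apply hx]; exact Φ.right_inv (hΦ.mem_target hx)

theorem coord_apply (hΦ : IsTrivialization EG EP EM G p U Φ) (a : G) {m : M} (hm : m ∈ U) :
    hΦ.coord (Φ (a, m)) = a :=
  congrArg Prod.fst (Φ.left_inv (hΦ.mem_source a hm))

theorem mdifferentiableAt_symm (hΦ : IsTrivialization EG EP EM G p U Φ) {x : P} (hx : p x ∈ U) :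
    MDifferentiableAt 𝓘(ℝ, EP) (𝓘(ℝ, EG).prod 𝓘(ℝ, EM)) Φ.symm x :=
  Φ.symm.mdifferentiableAt (by simp) (hΦ.mem_target hx)

end IsTrivialization

theorem IsFlat.exists_isFlatTrivialization {p : P → M} {θ : LieForm EG EP G P}
    (h : IsFlat EG EP EM G p θ) (m : M) : ∃ (U : Set M)
      (Φ : PartialDiffeomorph (𝓘(ℝ, EG).prod 𝓘(ℝ, EM)) 𝓘(ℝ, EP) (G × M) P ∞),
      m ∈ U ∧ IsFlatTrivialization p θ U Φ := by
  obtain ⟨U, -, hm, Φ, h1, h2⟩ := h m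
  exact ⟨U, Φ, hm, h1, h2⟩

namespace IsFlatTrivialization

variable {p : P → M} {θ : LieForm EG EP G P} {U : Set M}
  {Φ : PartialDiffeomorph (𝓘(ℝ, EG).prod 𝓘(ℝ, EM)) 𝓘(ℝ, EP) (G × M) P ∞}

/-- The point `x` is a variable tied to `Φ z` by an equation because the type of `θ x` depends on
`x`, which obstructs rewriting. -/
theorem form_mfderiv (hΦ : IsFlatTrivialization p θ U Φ) {z : G × M} (hz : z.2 ∈ U) {x : P}
    (hx : Φ z = x) (v : TangentSpace (𝓘(ℝ, EG).prod 𝓘(ℝ, EM)) z) :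
    θ x (mfderiv (𝓘(ℝ, EG).prod 𝓘(ℝ, EM)) 𝓘(ℝ, EP) Φ z v) = canonicalFlatForm EG EM G M z v := by
  subst hx
  exact hΦ.form_apply z.1 z.2 hz v

/-- If a map into the total space is annihilated by the connection at a point, then the derivative
of its `G`-coordinate vanishes there. -/
theorem mfderiv_coord_eq_zero [LieGroup 𝓘(ℝ, EG) ∞ G] (hΦ : IsFlatTrivialization p θ U Φ)
    (hp : ContMDiff 𝓘(ℝ, EP) 𝓘(ℝ, EM) ∞ p)
    {f : X → P} {x : X} (hx : p (f x) ∈ U) (hf : MDifferentiableAt 𝓘(ℝ, EX) 𝓘(ℝ, EP) f x)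
    (h0 : ∀ v, θ (f x) (mfderiv 𝓘(ℝ, EX) 𝓘(ℝ, EP) f x v) = 0) :
    MDifferentiableAt 𝓘(ℝ, EX) 𝓘(ℝ, EG) (fun y => hΦ.coord (f y)) x ∧
      mfderiv 𝓘(ℝ, EX) 𝓘(ℝ, EG) (fun y => hΦ.coord (f y)) x = 0 := by
  set b : X → G × M := fun y => Φ.symm (f y) with hb
  have hbd : MDifferentiableAt 𝓘(ℝ, EX) (𝓘(ℝ, EG).prod 𝓘(ℝ, EM)) b x :=
    (hΦ.mdifferentiableAt_symm hx).comp x hf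
  have hbU : (b x).2 ∈ U := by simp only [hb, hΦ.symm_apply hx]; exact hx
  have hbx : Φ (b x) = f x := Φ.right_inv (hΦ.mem_target hx)
  have had : MDifferentiableAt 𝓘(ℝ, EX) 𝓘(ℝ, EG) (fun y => (b y).1) x := hbd.fst
  refine ⟨had, ?_⟩
  have hΦd : MDifferentiableAt (𝓘(ℝ, EG).prod 𝓘(ℝ, EM)) 𝓘(ℝ, EP) Φ (b x) :=
    Φ.mdifferentiableAt (by simp) (hΦ.mem_source _ hbU)
  have hfeq : f =ᶠ[𝓝 x] Φ ∘ b := by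
    have : ∀ᶠ y in 𝓝 x, p (f y) ∈ U :=
      (hp.continuous.continuousAt.comp hf.continuousAt) (hΦ.isOpen.mem_nhds hx)
    filter_upwards [this] with y hy
    exact (Φ.right_inv (hΦ.mem_target hy)).symm
  have hder : mfderiv 𝓘(ℝ, EX) 𝓘(ℝ, EP) f x =
      (mfderiv (𝓘(ℝ, EG).prod 𝓘(ℝ, EM)) 𝓘(ℝ, EP) Φ (b x)).comp
        (mfderiv 𝓘(ℝ, EX) (𝓘(ℝ, EG).prod 𝓘(ℝ, EM)) b x) := by
    rw [hfeq.mfderiv_eq, mfderiv_comp x hΦd hbd]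
  have hmul (c : G) : ContMDiff 𝓘(ℝ, EG) 𝓘(ℝ, EG) ∞ (fun g : G => g * c) := contMDiff_mul_right
  have hmulz : MDifferentiableAt (𝓘(ℝ, EG).prod 𝓘(ℝ, EM)) 𝓘(ℝ, EG)
      (fun y : G × M => y.1 * (b x).1⁻¹) (b x) :=
    ((hmul _).mdifferentiable (by simp) _).comp (b x) mdifferentiableAt_fst
  -- The canonical form at `b x` is the derivative of right translation by the inverse of the frozen
  -- coordinate `(b x).1`, so horizontality kills the derivative of this quotient. Translating back
  -- then gives the claim.
  have hzero : mfderiv 𝓘(ℝ, EX) 𝓘(ℝ, EG) (fun y => (b y).1 * (b x).1⁻¹) x = 0 := by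
    have h1 : mfderiv 𝓘(ℝ, EX) 𝓘(ℝ, EG) (fun y => (b y).1 * (b x).1⁻¹) x =
      (canonicalFlatForm EG EM G M (b x)).comp
        (mfderiv 𝓘(ℝ, EX) (𝓘(ℝ, EG).prod 𝓘(ℝ, EM)) b x) :=
      mfderiv_comp x hmulz hbd
    rw [h1]
    ext v
    have h2 := hΦ.form_mfderiv hbU hbx (mfderiv 𝓘(ℝ, EX) (𝓘(ℝ, EG).prod 𝓘(ℝ, EM)) b x v)
    have h3 := h0 v
    rw [hder] at h3
    exact h2.symm.trans h3
  have hback : (fun y => (b y).1) =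
      (fun g : G => g * (b x).1) ∘ (fun y => (b y).1 * (b x).1⁻¹) := by
    ext y; simp
  have had' : MDifferentiableAt 𝓘(ℝ, EX) 𝓘(ℝ, EG) (fun y => (b y).1 * (b x).1⁻¹) x :=
    ((hmul _).mdifferentiable (by simp) _).comp x had
  change mfderiv 𝓘(ℝ, EX) 𝓘(ℝ, EG) (fun y => (b y).1) x = 0
  rw [hback, mfderiv_comp x ((hmul _).mdifferentiable (by simp) _) had', hzero]
  exact ContinuousLinearMap.comp_zero _

/-- A map annihilated by the connection has locally constant `G`-coordinate. -/
theorem eventually_coord_eq [LieGroup 𝓘(ℝ, EG) ∞ G] [IsManifold 𝓘(ℝ, EX) 1 X]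
    (hΦ : IsFlatTrivialization p θ U Φ) (hp : ContMDiff 𝓘(ℝ, EP) 𝓘(ℝ, EM) ∞ p)
    {f : X → P} {x : X} (hx : p (f x) ∈ U)
    (h : ∀ᶠ y in 𝓝 x, MDifferentiableAt 𝓘(ℝ, EX) 𝓘(ℝ, EP) f y ∧
      ∀ v, θ (f y) (mfderiv 𝓘(ℝ, EX) 𝓘(ℝ, EP) f y v) = 0) :
    ∀ᶠ y in 𝓝 x, p (f y) ∈ U ∧ hΦ.coord (f y) = hΦ.coord (f x) := by
  have : IsManifold 𝓘(ℝ, EG) 1 G := IsManifold.of_le (n := ∞) (by simp)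
  have hU : ∀ᶠ y in 𝓝 x, p (f y) ∈ U :=
    (hp.continuous.continuousAt.comp h.self_of_nhds.1.continuousAt) (hΦ.isOpen.mem_nhds hx)
  refine hU.and (eventually_eq_of_mfderiv_eq_zero (EX := EX) (EG := EG) ?_)
  filter_upwards [h, hU] with y hy hyU
  exact hΦ.mfderiv_coord_eq_zero hp hyU hy.1 hy.2

/-- The horizontal sections of a flat trivialization. -/
theorem form_section [LieGroup 𝓘(ℝ, EG) ∞ G] (hΦ : IsFlatTrivialization p θ U Φ) (a : G)
    {m : M} (hm : m ∈ U) :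
    MDifferentiableAt 𝓘(ℝ, EM) 𝓘(ℝ, EP) (fun m => Φ (a, m)) m ∧
      ∀ v, θ (Φ (a, m)) (mfderiv 𝓘(ℝ, EM) 𝓘(ℝ, EP) (fun m => Φ (a, m)) m v) = 0 := by
  have hΦd : MDifferentiableAt (𝓘(ℝ, EG).prod 𝓘(ℝ, EM)) 𝓘(ℝ, EP) Φ (a, m) :=
    Φ.mdifferentiableAt (by simp) (hΦ.mem_source a hm)
  have hι : MDifferentiableAt 𝓘(ℝ, EM) (𝓘(ℝ, EG).prod 𝓘(ℝ, EM)) (fun m : M => (a, m)) m :=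
    mdifferentiableAt_const.prodMk mdifferentiableAt_id
  refine ⟨hΦd.comp m hι, fun v => ?_⟩
  have h1 : mfderiv 𝓘(ℝ, EM) 𝓘(ℝ, EP) (fun m => Φ (a, m)) m =
      (mfderiv (𝓘(ℝ, EG).prod 𝓘(ℝ, EM)) 𝓘(ℝ, EP) Φ (a, m)).comp
        (mfderiv 𝓘(ℝ, EM) (𝓘(ℝ, EG).prod 𝓘(ℝ, EM)) (fun m : M => (a, m)) m) :=
    mfderiv_comp m hΦd hι
  have hmul : ContMDiff 𝓘(ℝ, EG) 𝓘(ℝ, EG) ∞ (fun g : G => g * a⁻¹) := contMDiff_mul_right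
  have hmulz : MDifferentiableAt (𝓘(ℝ, EG).prod 𝓘(ℝ, EM)) 𝓘(ℝ, EG)
      (fun y : G × M => y.1 * a⁻¹) (a, m) :=
    (hmul.mdifferentiable (by simp) _).comp (a, m) mdifferentiableAt_fst
  -- Along the slice `{a} × M` the function defining the canonical form is constant.
  have h2 : mfderiv 𝓘(ℝ, EM) 𝓘(ℝ, EG) (fun _ : M => a * a⁻¹) m =
      (canonicalFlatForm EG EM G M (a, m)).comp
        (mfderiv 𝓘(ℝ, EM) (𝓘(ℝ, EG).prod 𝓘(ℝ, EM)) (fun m : M => (a, m)) m) :=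
    mfderiv_comp m hmulz hι
  rw [mfderiv_const] at h2
  rw [h1]
  exact (hΦ.form_apply a m hm _).trans (DFunLike.congr_fun h2 v).symm

end IsFlatTrivialization

end FlatTrivialization

/-! ### The leaf topology and its covering map -/

section LeafSpace

variable {EG EP EM : Type*}
  [NormedAddCommGroup EG] [NormedSpace ℝ EG]
  [NormedAddCommGroup EP] [NormedSpace ℝ EP]
  [NormedAddCommGroup EM] [NormedSpace ℝ EM]
  {G : Type*} [TopologicalSpace G] [ChartedSpace EG G] [Group G]
  {P : Type*} [TopologicalSpace P] [ChartedSpace EP P] [MulAction G P]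
  {M : Type*} [TopologicalSpace M] [ChartedSpace EM M]

/-- The total space of a flat bundle, to be endowed with the topology whose connected components
are the horizontal leaves. -/
def LeafSpace (_EM : Type*) (_ : P → M) (_ : LieForm EG EP G P) : Type _ := P

/-- The identity map from the total space to the leaf space. -/
def LeafSpace.mk (EM : Type*) (p : P → M) (θ : LieForm EG EP G P) (x : P) : LeafSpace EM p θ := x

/-- The leaf topology: the finest one for which all horizontal local sections are continuous. -/
instance LeafSpace.instTopologicalSpace (p : P → M) (θ : LieForm EG EP G P) :
    TopologicalSpace (LeafSpace EM p θ) where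
  IsOpen W := ∀ (U : Set M)
    (Φ : PartialDiffeomorph (𝓘(ℝ, EG).prod 𝓘(ℝ, EM)) 𝓘(ℝ, EP) (G × M) P ∞),
    IsFlatTrivialization p θ U Φ → ∀ a : G, IsOpen {m | m ∈ U ∧ LeafSpace.mk EM p θ (Φ (a, m)) ∈ W}
  isOpen_univ U Φ hΦ a := by simpa using hΦ.isOpen
  isOpen_inter W W' h h' U Φ hΦ a := by
    convert (h U Φ hΦ a).inter (h' U Φ hΦ a) using 1
    ext m
    exact ⟨fun ⟨h1, h2, h3⟩ => ⟨⟨h1, h2⟩, h1, h3⟩, fun ⟨⟨h1, h2⟩, _, h3⟩ => ⟨h1, h2, h3⟩⟩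
  isOpen_sUnion S h U Φ hΦ a := by
    convert isOpen_biUnion (fun W hW => h W hW U Φ hΦ a) using 1
    ext m
    simp only [mem_iUnion]
    exact ⟨fun ⟨h1, W, hW, h2⟩ => ⟨W, hW, h1, h2⟩, fun ⟨W, hW, h1, h2⟩ => ⟨h1, W, hW, h2⟩⟩

namespace LeafSpace

instance (p : P → M) (θ : LieForm EG EP G P) : MulAction G (LeafSpace EM p θ) :=
  inferInstanceAs (MulAction G P)

variable {p : P → M} {θ : LieForm EG EP G P} {U : Set M}
  {Φ : PartialDiffeomorph (𝓘(ℝ, EG).prod 𝓘(ℝ, EM)) 𝓘(ℝ, EP) (G × M) P ∞}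

/-- The identity map from the leaf space to the total space. -/
def out (x : LeafSpace EM p θ) : P := x

/-- The projection of the leaf space to the base. -/
def proj (x : LeafSpace EM p θ) : M := p x.out

theorem isOpen_iff {W : Set (LeafSpace EM p θ)} : IsOpen W ↔ ∀ (U : Set M)
    (Φ : PartialDiffeomorph (𝓘(ℝ, EG).prod 𝓘(ℝ, EM)) 𝓘(ℝ, EP) (G × M) P ∞),
    IsFlatTrivialization p θ U Φ → ∀ a : G, IsOpen {m | m ∈ U ∧ mk EM p θ (Φ (a, m)) ∈ W} :=
  Iff.rfl

theorem continuous_out : Continuous (out : LeafSpace EM p θ → P) := by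
  refine ⟨fun W hW => isOpen_iff.2 fun U Φ hΦ a => ?_⟩
  have h1 : ContinuousOn (fun m => Φ (a, m)) U :=
    Φ.contMDiffOn_toFun.continuousOn.comp (Continuous.prodMk_right a).continuousOn
      fun m hm => hΦ.mem_source a hm
  exact h1.isOpen_inter_preimage hΦ.isOpen hW

/-- On the slice through `x`, an open set of the leaf space is an open set of the base, so it
suffices to stay on that slice and converge in the base. -/
theorem tendsto_mk (hΦ : IsFlatTrivialization p θ U Φ) {α : Type*} {l : Filter α} {f : α → P}
    {x : P} (hx : p x ∈ U) (h : ∀ᶠ y in l, p (f y) ∈ U ∧ hΦ.coord (f y) = hΦ.coord x)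
    (hp : Filter.Tendsto (fun y => p (f y)) l (𝓝 (p x))) :
    Filter.Tendsto (fun y => mk EM p θ (f y)) l (𝓝 (mk EM p θ x)) := by
  rw [tendsto_nhds]
  intro W hW hxW
  have h1 := (isOpen_iff.1 hW U Φ hΦ (hΦ.coord x)).mem_nhds
    (show p x ∈ _ from ⟨hx, by rw [hΦ.apply_coord hx]; exact hxW⟩)
  filter_upwards [h, hp h1] with y hy hy'
  have h2 := hy'.2
  rw [← hy.2, hΦ.apply_coord hy.1] at h2
  exact h2

theorem continuousAt_mk_section (hΦ : IsFlatTrivialization p θ U Φ) (a : G) {m : M} (hm : m ∈ U) :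
    ContinuousAt (fun m => mk EM p θ (Φ (a, m))) m := by
  have hp1 : ∀ m ∈ U, p (Φ (a, m)) = m := hΦ.proj_apply a
  refine tendsto_mk hΦ (by rwa [hp1 m hm]) ?_ ?_
  · filter_upwards [hΦ.isOpen.mem_nhds hm] with y hy
    rw [hp1 y hy, hΦ.coord_apply a hy, hΦ.coord_apply a hm]
    exact ⟨hy, rfl⟩
  · rw [hp1 m hm]
    refine Filter.tendsto_id.congr' ?_
    filter_upwards [hΦ.isOpen.mem_nhds hm] with y hy
    exact (hp1 y hy).symm

variable [LieGroup 𝓘(ℝ, EG) ∞ G] [IsManifold 𝓘(ℝ, EM) 1 M]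

/-- Openness is tested on the slices of every other flat trivialization `Ψ`. Such a slice is
horizontal, so its `Φ`-coordinate is locally constant. Plaques thus provide neighbourhoods on which
the coordinate is fixed. -/
theorem isOpen_plaque (hp : ContMDiff 𝓘(ℝ, EP) 𝓘(ℝ, EM) ∞ p) (hΦ : IsFlatTrivialization p θ U Φ)
    (a : G) {V : Set M} (hV : IsOpen V) :
    IsOpen {x : LeafSpace EM p θ | p x.out ∈ V ∩ U ∧ hΦ.coord x.out = a} := by
  rw [isOpen_iff]
  intro U' Ψ hΨ b
  rw [isOpen_iff_mem_nhds]
  rintro m ⟨hm, hm', hma⟩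
  have hpm : ∀ y ∈ U', p (Ψ (b, y)) = y := hΨ.proj_apply b
  have h1 := hΦ.eventually_coord_eq (EX := EM) hp (f := fun m => Ψ (b, m)) (x := m) hm'.2 (by
    filter_upwards [hΨ.isOpen.mem_nhds hm] with y hy
    exact hΨ.form_section b hy)
  change p (Ψ (b, m)) ∈ V ∩ U at hm'
  rw [hpm m hm] at hm'
  filter_upwards [h1, hΨ.isOpen.mem_nhds hm, hV.mem_nhds hm'.1] with y hy hyU hyV
  refine ⟨hyU, ⟨?_, hy.1⟩, hy.2.trans hma⟩
  change p (Ψ (b, y)) ∈ V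
  rwa [hpm y hyU]

theorem eventually_coord_eq (hp : ContMDiff 𝓘(ℝ, EP) 𝓘(ℝ, EM) ∞ p)
    (hΦ : IsFlatTrivialization p θ U Φ) {α : Type*} {l : Filter α} {f : α → LeafSpace EM p θ}
    {x : LeafSpace EM p θ} (hx : p x.out ∈ U) (h : Filter.Tendsto f l (𝓝 x)) :
    ∀ᶠ y in l, p (f y).out ∈ U ∧ hΦ.coord (f y).out = hΦ.coord x.out := by
  filter_upwards [h ((isOpen_plaque hp hΦ (hΦ.coord x.out) hΦ.isOpen).mem_nhds ⟨⟨hx, hx⟩, rfl⟩)]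
    with y hy
  exact ⟨hy.1.1, hy.2⟩

/-- Over `U` the leaf space is a union of plaques indexed by `G`, and `g` moves the plaque of
coordinate `a` to that of coordinate `g * a`. Plaques are therefore disjoint from their translates
by `g ≠ 1`, and a quotient of coordinates carries any point of a fibre to any other. -/
theorem isQuotientCoveringMap (hp : IsPrincipalBundle EG EP EM G p)
    (hflat : IsFlat EG EP EM G p θ) :
    IsQuotientCoveringMap (proj : LeafSpace EM p θ → M) G := by
  have hcont : Continuous (proj : LeafSpace EM p θ → M) :=
    hp.contMDiff_proj.continuous.comp continuous_out
  have hsurj : Function.Surjective (proj : LeafSpace EM p θ → M) := fun m => by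
    obtain ⟨U, Φ, hm, hΦ⟩ := hflat.exists_isFlatTrivialization m
    exact ⟨mk EM p θ (Φ (1, m)), hΦ.proj_apply 1 m hm⟩
  have hopen : IsOpenMap (proj : LeafSpace EM p θ → M) := fun W hW => by
    rw [isOpen_iff_mem_nhds]
    rintro _ ⟨x, hx, rfl⟩
    obtain ⟨U, Φ, hm, hΦ⟩ := hflat.exists_isFlatTrivialization (proj x)
    refine Filter.mem_of_superset ((isOpen_iff.1 hW U Φ hΦ (hΦ.coord x.out)).mem_nhds
      ⟨hm, ?_⟩) fun m hm => ⟨_, hm.2, hΦ.proj_apply _ m hm.1⟩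
    change mk EM p θ (Φ (hΦ.coord x.out, p x.out)) ∈ W
    rwa [hΦ.apply_coord hm]
  refine ⟨hopen.isQuotientMap hcont hsurj, ⟨fun g => ⟨fun W hW => ?_⟩⟩, fun {x y} => ?_,
    fun x => ?_⟩
  · refine isOpen_iff.2 fun U Φ hΦ a => ?_
    convert isOpen_iff.1 hW U Φ hΦ (g * a) using 1
    ext m
    refine and_congr_right fun hm => ?_
    rw [hΦ.equivariant g a m hm]
    rfl
  · constructor
    · intro h
      obtain ⟨U, Φ, hm, hΦ⟩ := hflat.exists_isFlatTrivialization (proj x)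
      have hm' : p y.out ∈ U := by change proj y ∈ U; rwa [← h]
      refine ⟨hΦ.coord x.out * (hΦ.coord y.out)⁻¹, ?_⟩
      change (hΦ.coord x.out * (hΦ.coord y.out)⁻¹) • y.out = x.out
      conv_lhs => rw [← hΦ.apply_coord hm']
      rw [← hΦ.equivariant _ _ _ hm']
      simp only [hΦ.coord_apply _ hm', inv_mul_cancel_right]
      rw [show p y.out = p x.out from h.symm]
      exact hΦ.apply_coord hm
    · rintro ⟨g, rfl⟩
      exact hp.proj_smul g y.out
  · obtain ⟨U, Φ, hm, hΦ⟩ := hflat.exists_isFlatTrivialization (proj x)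
    refine ⟨_, (isOpen_plaque hp.contMDiff_proj hΦ (hΦ.coord x.out) hΦ.isOpen).mem_nhds
      ⟨⟨hm, hm⟩, rfl⟩, ?_⟩
    rintro g ⟨_, ⟨y, hy, rfl⟩, hgy⟩
    have h1 : (g • y).out = Φ (g * hΦ.coord y.out, p y.out) := by
      rw [hΦ.equivariant _ _ _ hy.1.1, hΦ.apply_coord hy.1.1]; rfl
    have h2 := hgy.2
    rw [h1, hΦ.coord_apply _ hy.1.1, hy.2] at h2
    simpa using h2

end LeafSpace

end LeafSpace

/-! ### Horizontal curves stay in leaves -/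

section HorizontalOn

variable {EG EP EM : Type*}
  [NormedAddCommGroup EG] [NormedSpace ℝ EG]
  [NormedAddCommGroup EP] [NormedSpace ℝ EP]
  [NormedAddCommGroup EM] [NormedSpace ℝ EM]
  {G : Type*} [TopologicalSpace G] [ChartedSpace EG G] [Group G]
  {P : Type*} [TopologicalSpace P] [ChartedSpace EP P]
  {M : Type*} [TopologicalSpace M] [ChartedSpace EM M]

/-- The curve `f` is smooth on `[a, b]`, with velocity annihilated by `θ` on `(a, b)`. -/
def SmoothHorizontalOn (θ : LieForm EG EP G P) (f : ℝ → P) (a b : ℝ) : Prop :=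
  ContMDiffOn 𝓘(ℝ, ℝ) 𝓘(ℝ, EP) ∞ f (Icc a b) ∧
    ∀ s ∈ Ioo a b, θ (f s) (mfderiv 𝓘(ℝ, ℝ) 𝓘(ℝ, EP) f s (1 : ℝ)) = 0

/-- The curve `f` is piecewise smooth on `[a, b]`, with velocity annihilated by `θ`. -/
def HorizontalOn (θ : LieForm EG EP G P) (f : ℝ → P) (a b : ℝ) : Prop :=
  ∃ (k : ℕ) (t : ℕ → ℝ), Monotone t ∧ t 0 = a ∧ t k = b ∧
    ∀ i < k, SmoothHorizontalOn θ f (t i) (t (i + 1))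

variable {θ : LieForm EG EP G P} {f g : ℝ → P} {a b c : ℝ}

theorem isHorizontal_iff {x y : P} {γ : Path x y} :
    IsHorizontal θ γ ↔ HorizontalOn θ γ.extend 0 1 := Iff.rfl

/-- Horizontality of a curve tests only the vector `1`, which spans the tangent space of `ℝ`. -/
theorem form_mfderiv_eq_zero {s : ℝ}
    (h : θ (f s) (mfderiv 𝓘(ℝ, ℝ) 𝓘(ℝ, EP) f s (1 : ℝ)) = 0) (v : TangentSpace 𝓘(ℝ, ℝ) s) :
    θ (f s) (mfderiv 𝓘(ℝ, ℝ) 𝓘(ℝ, EP) f s v) = 0 := by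
  let r : ℝ := v
  let L : ℝ →L[ℝ] EG := (θ (f s)).comp (mfderiv 𝓘(ℝ, ℝ) 𝓘(ℝ, EP) f s)
  have h1 : L (r • (1 : ℝ)) = r • L 1 := L.map_smul r 1
  have h2 : L 1 = 0 := h
  rw [h2, smul_zero, smul_eq_mul, mul_one] at h1
  exact h1

namespace SmoothHorizontalOn

theorem congr (h : SmoothHorizontalOn θ f a b) (hfg : EqOn g f (Icc a b)) :
    SmoothHorizontalOn θ g a b := by
  refine ⟨h.1.congr hfg, fun s hs => ?_⟩
  have h1 : g =ᶠ[𝓝 s] f :=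
    Filter.eventually_of_mem (Icc_mem_nhds hs.1 hs.2) fun x hx => hfg hx
  have h2 := h.2 s hs
  rw [h1.mfderiv_eq, hfg (Ioo_subset_Icc_self hs)]
  exact h2

theorem comp_affine (h : SmoothHorizontalOn θ f a b) {r : ℝ} (hr : 0 < r) (d : ℝ) :
    SmoothHorizontalOn θ (fun s => f (r * s + d)) ((a - d) / r) ((b - d) / r) := by
  have hA : ContMDiff 𝓘(ℝ, ℝ) 𝓘(ℝ, ℝ) ∞ (fun s : ℝ => r * s + d) :=
    contMDiff_iff_contDiff.2 (by fun_prop)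
  refine ⟨h.1.comp hA.contMDiffOn fun s hs => ?_, fun s hs => ?_⟩
  · rw [mem_Icc, div_le_iff₀ hr, le_div_iff₀ hr] at hs
    exact ⟨by linarith, by linarith⟩
  · rw [mem_Ioo, div_lt_iff₀ hr, lt_div_iff₀ hr] at hs
    have hs' : r * s + d ∈ Ioo a b := ⟨by linarith, by linarith⟩
    have h1 : MDifferentiableAt 𝓘(ℝ, ℝ) 𝓘(ℝ, EP) f (r * s + d) :=
      (h.1.contMDiffAt (Icc_mem_nhds hs'.1 hs'.2)).mdifferentiableAt (by simp)
    have h2 : mfderiv 𝓘(ℝ, ℝ) 𝓘(ℝ, EP) (fun s => f (r * s + d)) s =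
        (mfderiv 𝓘(ℝ, ℝ) 𝓘(ℝ, EP) f (r * s + d)).comp
          (mfderiv 𝓘(ℝ, ℝ) 𝓘(ℝ, ℝ) (fun s : ℝ => r * s + d) s) :=
      mfderiv_comp s h1 (hA.mdifferentiable (by simp) s)
    have h3 : mfderiv 𝓘(ℝ, ℝ) 𝓘(ℝ, ℝ) (fun s : ℝ => r * s + d) s (1 : ℝ) = r := by
      rw [mfderiv_eq_fderiv]
      have : HasDerivAt (fun s : ℝ => r * s + d) (r * 1) s :=
        ((hasDerivAt_id s).const_mul r).add_const d
      rw [this.hasFDerivAt.fderiv]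
      exact (ContinuousLinearMap.toSpanSingleton_apply_one ℝ (r * 1)).trans (mul_one r)
    have h4 : mfderiv 𝓘(ℝ, ℝ) 𝓘(ℝ, EP) (fun s => f (r * s + d)) s (1 : ℝ) =
        mfderiv 𝓘(ℝ, ℝ) 𝓘(ℝ, EP) f (r * s + d) r := by
      rw [h2]
      exact congrArg (mfderiv 𝓘(ℝ, ℝ) 𝓘(ℝ, EP) f (r * s + d)) h3
    rw [h4]
    exact form_mfderiv_eq_zero (h.2 _ hs') r

theorem horizontalOn (h : SmoothHorizontalOn θ f a b) (hab : a ≤ b) : HorizontalOn θ f a b := by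
  -- Subdivisions are indexed by all of `ℕ`; past the last index the end point is repeated.
  refine ⟨1, fun i => if i = 0 then a else b, ?_, rfl, rfl, fun i hi => ?_⟩
  · refine monotone_nat_of_le_succ fun n => ?_
    rcases n with _ | n <;> simp [hab]
  · obtain rfl : i = 0 := by omega
    exact h

end SmoothHorizontalOn

namespace HorizontalOn

theorem congr (h : HorizontalOn θ f a b) (hfg : EqOn g f (Icc a b)) : HorizontalOn θ g a b := by
  obtain ⟨k, t, ht, h0, h1, h⟩ := h
  refine ⟨k, t, ht, h0, h1, fun i hi => (h i hi).congr (hfg.mono (Icc_subset_Icc ?_ ?_))⟩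
  · rw [← h0]; exact ht (Nat.zero_le _)
  · rw [← h1]; exact ht hi

theorem comp_affine (h : HorizontalOn θ f a b) {r : ℝ} (hr : 0 < r) (d : ℝ) :
    HorizontalOn θ (fun s => f (r * s + d)) ((a - d) / r) ((b - d) / r) := by
  obtain ⟨k, t, ht, h0, h1, h⟩ := h
  refine ⟨k, fun i => (t i - d) / r, fun i j hij => ?_, congrArg (fun u => (u - d) / r) h0,
    congrArg (fun u => (u - d) / r) h1,
    fun i hi => (h i hi).comp_affine hr d⟩
  have := ht hij
  dsimp only
  gcongr

theorem trans (h : HorizontalOn θ f a b) (h' : HorizontalOn θ f b c) : HorizontalOn θ f a c := by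
  obtain ⟨k, t, ht, h0, h1, h⟩ := h
  obtain ⟨k', t', ht', h0', h1', h'⟩ := h'
  have hle : ∀ i ≤ k, t i ≤ b := fun i hi => h1 ▸ ht hi
  have hle' : ∀ i, b ≤ t' i := fun i => h0' ▸ ht' (Nat.zero_le i)
  have hlt : ∀ i < k, (i ≤ k ∧ i + 1 ≤ k) := fun i hi => by omega
  -- At index `k` both formulas give `b`, as `t k = b = t' 0`.
  refine ⟨k + k', fun i => if i ≤ k then t i else t' (i - k), ?_, by simpa using h0, ?_, ?_⟩
  · intro i j hij
    dsimp only
    split_ifs with hi hj hj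
    · exact ht hij
    · exact (hle i hi).trans (hle' _)
    · omega
    · exact ht' (by omega)
  · dsimp only
    split_ifs with hk
    · obtain rfl : k' = 0 := by omega
      rw [← h1', h0', ← h1, add_zero]
    · rw [Nat.add_sub_cancel_left, h1']
  · intro i hi
    by_cases hik : i < k
    · simp only [(hlt i hik).1, (hlt i hik).2, if_true]
      exact h i hik
    · obtain ⟨j, rfl⟩ : ∃ j, i = k + j := ⟨i - k, by omega⟩
      have h2 : (if k + j ≤ k then t (k + j) else t' (k + j - k)) = t' j := by
        split_ifs with hj
        · obtain rfl : j = 0 := by omega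
          rw [add_zero, h1, h0']
        · rw [Nat.add_sub_cancel_left]
      have h3 : (if k + j + 1 ≤ k then t (k + j + 1) else t' (k + j + 1 - k)) = t' (j + 1) := by
        rw [if_neg (by omega)]
        congr 1
        omega
      simp only [h2, h3]
      exact h' j (by omega)

end HorizontalOn

theorem IsHorizontal.trans {x y z : P} {γ : Path x y} {γ' : Path y z} (h : IsHorizontal θ γ)
    (h' : IsHorizontal θ γ') : IsHorizontal θ (γ.trans γ') := by
  rw [isHorizontal_iff] at *
  -- Concatenation runs through `2 s` on `[0, 1/2]` and `2 s - 1` on `[1/2, 1]`.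
  have h1 := h.comp_affine two_pos 0
  have h2 := h'.comp_affine two_pos (-1)
  norm_num at h1 h2
  refine HorizontalOn.trans (b := 1 / 2) (h1.congr fun s hs => ?_) (h2.congr fun s hs => ?_)
  · exact γ.extend_trans_of_le_half γ' hs.2
  · rw [γ.extend_trans_of_half_le γ' hs.1, sub_eq_add_neg]

variable [MulAction G P] {p : P → M} {U : Set M}
  {Φ : PartialDiffeomorph (𝓘(ℝ, EG).prod 𝓘(ℝ, EM)) 𝓘(ℝ, EP) (G × M) P ∞}

/-- `G` injects continuously into a fibre of `P`. Separation is needed to extend an equality of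
`G`-coordinates from an open interval to its closure. -/
theorem IsTrivialization.t2Space [T2Space P] (hΦ : IsTrivialization EG EP EM G p U Φ) {m : M}
    (hm : m ∈ U) : T2Space G := by
  refine T2Space.of_injective_continuous (f := fun a : G => Φ (a, m)) (fun a b hab => ?_) ?_
  · rw [← hΦ.coord_apply a hm, ← hΦ.coord_apply b hm]
    exact congrArg _ hab
  · rw [← continuousOn_univ]
    exact Φ.contMDiffOn_toFun.continuousOn.comp (Continuous.prodMk_left m).continuousOn
      fun a _ => hΦ.mem_source a hm

variable [T2Space P] [LieGroup 𝓘(ℝ, EG) ∞ G]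

/-- A horizontal curve stays in a leaf. -/
theorem SmoothHorizontalOn.continuousOn_mk (hp : ContMDiff 𝓘(ℝ, EP) 𝓘(ℝ, EM) ∞ p)
    (hflat : IsFlat EG EP EM G p θ) (h : SmoothHorizontalOn θ f a b) :
    ContinuousOn (fun s => LeafSpace.mk EM p θ (f s)) (Icc a b) := by
  rcases le_or_gt b a with hab | hab
  · exact (subsingleton_Icc_of_ge hab).continuousOn _
  intro s hs
  obtain ⟨U, Φ, hm, hΦ⟩ := hflat.exists_isFlatTrivialization (p (f s))
  have : T2Space G := hΦ.t2Space hm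
  have hpf : ContinuousOn (fun s => p (f s)) (Icc a b) :=
    hp.continuous.comp_continuousOn h.1.continuousOn
  obtain ⟨r, hr, hball⟩ := Metric.mem_nhdsWithin_iff.1 (hpf s hs (hΦ.isOpen.mem_nhds hm))
  have hcoord : ContinuousOn (fun s => hΦ.coord (f s)) (Metric.ball s r ∩ Icc a b) := by
    refine continuous_fst.comp_continuousOn ?_
    exact Φ.symm.contMDiffOn_toFun.continuousOn.comp (h.1.continuousOn.mono inter_subset_right)
      fun s' hs' => hΦ.mem_target (hball hs')
  have hsub : Metric.ball s r ∩ Ioo a b ⊆ Metric.ball s r ∩ Icc a b :=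
    inter_subset_inter_right _ Ioo_subset_Icc_self
  have hpre : IsPreconnected (Metric.ball s r ∩ Ioo a b) :=
    ((convex_ball s r).inter (convex_Ioo a b)).isPreconnected
  -- The coordinate is locally constant on an interval, hence constant.
  have hconst : ∀ u ∈ Metric.ball s r ∩ Ioo a b, ∀ v ∈ Metric.ball s r ∩ Ioo a b,
      hΦ.coord (f u) = hΦ.coord (f v) := by
    intro u hu v hv
    refine hpre.induction₂ (fun u v => hΦ.coord (f u) = hΦ.coord (f v)) ?_
      (fun _ _ _ _ _ _ h1 h2 => h1.trans h2) (fun _ _ _ _ h1 => h1.symm) hu hv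
    intro w hw
    refine Filter.Eventually.filter_mono nhdsWithin_le_nhds ?_
    have := hΦ.eventually_coord_eq (EX := ℝ) hp (f := f) (x := w) (hball (hsub hw)) (by
      filter_upwards [isOpen_Ioo.mem_nhds hw.2] with y hy
      have hd : MDifferentiableAt 𝓘(ℝ, ℝ) 𝓘(ℝ, EP) f y :=
        (h.1.contMDiffAt (Icc_mem_nhds hy.1 hy.2)).mdifferentiableAt (by simp)
      exact ⟨hd, form_mfderiv_eq_zero (h.2 _ hy)⟩)
    filter_upwards [this] with y hy
    exact hy.2.symm
  -- The velocity condition says nothing at `a` and `b`; these points are reached by continuity.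
  have hcl : Metric.ball s r ∩ Icc a b ⊆ closure (Metric.ball s r ∩ Ioo a b) := by
    rw [← closure_Ioo hab.ne]
    exact Metric.isOpen_ball.inter_closure
  have hsmem : s ∈ Metric.ball s r ∩ Icc a b := ⟨Metric.mem_ball_self hr, hs⟩
  obtain ⟨u, hu⟩ : (Metric.ball s r ∩ Ioo a b).Nonempty :=
    closure_nonempty_iff.1 ⟨s, hcl hsmem⟩
  have heq : EqOn (fun s => hΦ.coord (f s)) (fun _ => hΦ.coord (f u))
      (Metric.ball s r ∩ Icc a b) :=
    EqOn.of_subset_closure (fun v hv => hconst v hv u hu) hcoord continuousOn_const hsub hcl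
  refine LeafSpace.tendsto_mk hΦ hm ?_ (hpf s hs)
  filter_upwards [inter_mem_nhdsWithin (Icc a b) (Metric.ball_mem_nhds s hr)] with v hv
  exact ⟨hball hv.symm, (heq hv.symm).trans (heq hsmem).symm⟩

theorem HorizontalOn.continuousOn_mk (hp : ContMDiff 𝓘(ℝ, EP) 𝓘(ℝ, EM) ∞ p)
    (hflat : IsFlat EG EP EM G p θ) (h : HorizontalOn θ f a b) :
    ContinuousOn (fun s => LeafSpace.mk EM p θ (f s)) (Icc a b) := by
  obtain ⟨k, t, ht, rfl, rfl, h⟩ := h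
  induction k with
  | zero => exact (subsingleton_Icc_of_ge le_rfl).continuousOn _
  | succ k ih =>
    rw [← Icc_union_Icc_eq_Icc (ht (Nat.zero_le k)) (ht (Nat.le_succ k))]
    exact (ih fun i hi => h i (by omega)).union_of_isClosed
      ((h k (by omega)).continuousOn_mk hp hflat) isClosed_Icc isClosed_Icc

theorem IsHorizontal.continuous_mk (hp : ContMDiff 𝓘(ℝ, EP) 𝓘(ℝ, EM) ∞ p)
    (hflat : IsFlat EG EP EM G p θ) {x y : P} {γ : Path x y} (h : IsHorizontal θ γ) :
    Continuous fun s => LeafSpace.mk EM p θ (γ s) := by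
  have h1 := (isHorizontal_iff.1 h).continuousOn_mk hp hflat
  refine (h1.comp_continuous continuous_subtype_val fun s => s.2).congr fun s => ?_
  exact congrArg _ (γ.extend_extends' s)

end HorizontalOn

/-! ### Holonomy as monodromy -/

section HorizontalHomotopy

variable {EG EP EM : Type*}
  [NormedAddCommGroup EG] [NormedSpace ℝ EG]
  [NormedAddCommGroup EP] [NormedSpace ℝ EP]
  [NormedAddCommGroup EM] [NormedSpace ℝ EM]
  {G : Type*} [TopologicalSpace G] [ChartedSpace EG G] [Group G]
  {P : Type*} [TopologicalSpace P] [ChartedSpace EP P] [MulAction G P]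
  {M : Type*} [TopologicalSpace M] [ChartedSpace EM M]
  {p : P → M} {θ : LieForm EG EP G P} {U : Set M}
  {Φ : PartialDiffeomorph (𝓘(ℝ, EG).prod 𝓘(ℝ, EM)) 𝓘(ℝ, EP) (G × M) P ∞}

/-- The path in the leaf space is homotopic to one which is horizontal as a path in the
total space. -/
def HomotopicToHorizontal {x y : LeafSpace EM p θ} (τ : Path x y) : Prop :=
  ∃ c : Path x y, IsHorizontal θ (c.map LeafSpace.continuous_out) ∧ c.Homotopic τ

/-- Handles paths whose end points agree only propositionally. -/
theorem HomotopicToHorizontal.of_eq {x y x' y' : LeafSpace EM p θ} {τ : Path x y}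
    {τ' : Path x' y'} (h : HomotopicToHorizontal τ) (hτ : ∀ s, τ s = τ' s) :
    HomotopicToHorizontal τ' := by
  have hx : x = x' := by simpa using hτ 0
  have hy : y = y' := by simpa using hτ 1
  subst hx hy
  rwa [show τ' = τ from Path.ext (funext fun s => (hτ s).symm)]

theorem HomotopicToHorizontal.trans {x y z : LeafSpace EM p θ} {τ : Path x y} {τ' : Path y z}
    (h : HomotopicToHorizontal τ) (h' : HomotopicToHorizontal τ') :
    HomotopicToHorizontal (τ.trans τ') := by
  obtain ⟨c, hc, hcτ⟩ := h
  obtain ⟨c', hc', hcτ'⟩ := h'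
  exact ⟨c.trans c', by rw [Path.map_trans]; exact hc.trans hc', hcτ.hcomp hcτ'⟩

theorem HomotopicToHorizontal.of_homotopic {x y : LeafSpace EM p θ} {τ τ' : Path x y}
    (h : HomotopicToHorizontal τ) (hτ : τ.Homotopic τ') : HomotopicToHorizontal τ' := by
  obtain ⟨c, hc, hcτ⟩ := h
  exact ⟨c, hc, hcτ.trans hτ⟩

variable [LieGroup 𝓘(ℝ, EG) ∞ G]

/-- The horizontal lift of a smooth curve in the base, in a flat trivialization. -/
theorem IsFlatTrivialization.smoothHorizontalOn (hΦ : IsFlatTrivialization p θ U Φ) (a : G)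
    {w : ℝ → M} {b c : ℝ} (hw : ContMDiffOn 𝓘(ℝ, ℝ) 𝓘(ℝ, EM) ∞ w (Icc b c))
    (hwU : ∀ s ∈ Icc b c, w s ∈ U) : SmoothHorizontalOn θ (fun s => Φ (a, w s)) b c := by
  refine ⟨Φ.contMDiffOn_toFun.comp (contMDiffOn_const.prodMk hw)
    fun s hs => hΦ.mem_source a (hwU s hs), fun s hs => ?_⟩
  have h1 := hΦ.form_section a (hwU s (Ioo_subset_Icc_self hs))
  have h2 : MDifferentiableAt 𝓘(ℝ, ℝ) 𝓘(ℝ, EM) w s :=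
    (hw.contMDiffAt (Icc_mem_nhds hs.1 hs.2)).mdifferentiableAt (by simp)
  have h3 : mfderiv 𝓘(ℝ, ℝ) 𝓘(ℝ, EP) (fun s => Φ (a, w s)) s =
      (mfderiv 𝓘(ℝ, EM) 𝓘(ℝ, EP) (fun m => Φ (a, m)) (w s)).comp
        (mfderiv 𝓘(ℝ, ℝ) 𝓘(ℝ, EM) w s) :=
    mfderiv_comp (g := fun m => Φ (a, m)) s h1.1 h2
  rw [h3]
  exact h1.2 _

variable [IsManifold 𝓘(ℝ, EM) ∞ M]

/-- The neighbourhood is a plaque over a chart ball `B`. A path in it is the image, under the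
horizontal section `β`, of a path in `B`. The latter is homotopic to a straight segment, whose image
under `β` is smooth and horizontal. -/
theorem LeafSpace.exists_nhds_homotopicToHorizontal (hp : ContMDiff 𝓘(ℝ, EP) 𝓘(ℝ, EM) ∞ p)
    (hflat : IsFlat EG EP EM G p θ) (x : LeafSpace EM p θ) :
    ∃ W ∈ 𝓝 x, ∀ (y z : LeafSpace EM p θ) (τ : Path y z), (∀ s, τ s ∈ W) →
      HomotopicToHorizontal τ := by
  have : IsManifold 𝓘(ℝ, EM) 1 M := IsManifold.of_le (n := ∞) (by simp)
  obtain ⟨U, Φ, hm, hΦ⟩ := hflat.exists_isFlatTrivialization (p x.out)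
  set m := p x.out with hmdef
  set a := hΦ.coord x.out
  set χ := extChartAt 𝓘(ℝ, EM) m with hχ
  have hχm : ContinuousAt χ.symm (χ m) := continuousAt_extChartAt_symm m
  have hχinv : χ.symm (χ m) = m := extChartAt_to_inv m
  rw [ContinuousAt, hχinv] at hχm
  obtain ⟨r, hr, hball⟩ := Metric.eventually_nhds_iff_ball.1
    ((hχm.eventually (hΦ.isOpen.mem_nhds hm)).and (extChartAt_target_mem_nhds m))
  set B := Metric.ball (χ m) r with hB
  have hV : IsOpen (χ.source ∩ χ ⁻¹' B) :=
    (continuousOn_extChartAt m).isOpen_inter_preimage (isOpen_extChartAt_source m)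
      Metric.isOpen_ball
  refine ⟨_, (LeafSpace.isOpen_plaque hp hΦ a hV).mem_nhds
    ⟨⟨⟨mem_extChartAt_source m, Metric.mem_ball_self hr⟩, hm⟩, rfl⟩, fun y z τ hτ => ?_⟩
  have hBne : B.Nonempty := ⟨χ m, Metric.mem_ball_self hr⟩
  have : ContractibleSpace B := (convex_ball (χ m) r).contractibleSpace hBne
  let β : C(B, LeafSpace EM p θ) :=
    { toFun := fun e => LeafSpace.mk EM p θ (Φ (a, χ.symm e))
      continuous_toFun := continuous_iff_continuousAt.2 fun e => by
        have h1 := LeafSpace.continuousAt_mk_section hΦ a (hball e e.2).1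
        have h2 : ContinuousAt χ.symm (e : EM) := continuousAt_extChartAt_symm'' (hball e e.2).2
        exact (h1.comp (x := (e : EM)) h2).comp continuous_subtype_val.continuousAt }
  have hpτ : Continuous fun s => p (τ s).out :=
    hp.continuous.comp (LeafSpace.continuous_out.comp τ.continuous)
  let τ' : C(unitInterval, B) :=
    { toFun := fun s => ⟨χ (p (τ s).out), (hτ s).1.1.2⟩
      continuous_toFun := Continuous.subtype_mk
        ((continuousOn_extChartAt m).comp_continuous hpτ fun s => (hτ s).1.1.1) _ }
  have hβτ : ∀ s, β (τ' s) = τ s := fun s => by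
    change LeafSpace.mk EM p θ (Φ (a, χ.symm (χ (p (τ s).out)))) = τ s
    rw [χ.left_inv (hτ s).1.1.1, ← (hτ s).2, hΦ.apply_coord (hτ s).1.2]
    rfl
  let τB : Path (τ' 0) (τ' 1) := ⟨τ', rfl, rfl⟩
  let L : ℝ → EM := fun s => AffineMap.lineMap (τ' 0 : EM) (τ' 1 : EM) s
  have hL : ∀ s ∈ Icc (0 : ℝ) 1, L s ∈ B := fun s hs =>
    (convex_ball (χ m) r).lineMap_mem (τ' 0).2 (τ' 1).2 hs
  have hLs : ContDiff ℝ ∞ L := by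
    have : L = fun s => s • ((τ' 1 : EM) - (τ' 0 : EM)) + (τ' 0 : EM) := by
      ext s; simp [L, AffineMap.lineMap_apply]
    rw [this]
    fun_prop
  let ℓ : Path (τ' 0) (τ' 1) :=
    { toFun := fun s => ⟨L s, hL s s.2⟩
      continuous_toFun := Continuous.subtype_mk (hLs.continuous.comp continuous_subtype_val) _
      source' := Subtype.ext (by simp [L])
      target' := Subtype.ext (by simp [L]) }
  refine HomotopicToHorizontal.of_eq (τ := τB.map β.continuous) ?_ hβτ
  refine ⟨ℓ.map β.continuous, ?_, (SimplyConnectedSpace.paths_homotopic ℓ τB).map β⟩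
  rw [isHorizontal_iff]
  have hsm : SmoothHorizontalOn θ (fun s => Φ (a, χ.symm (L s))) 0 1 := by
    refine hΦ.smoothHorizontalOn a ?_ fun s hs => (hball _ (hL s hs)).1
    exact (contMDiffOn_extChartAt_symm m).comp hLs.contMDiff.contMDiffOn
      fun s hs => (hball _ (hL s hs)).2
  refine (hsm.horizontalOn zero_le_one).congr fun s hs => ?_
  rw [Path.extend_apply _ hs]
  rfl

/-- Every path in a leaf is homotopic to a horizontal one. -/
theorem homotopicToHorizontal (hp : ContMDiff 𝓘(ℝ, EP) 𝓘(ℝ, EM) ∞ p)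
    (hflat : IsFlat EG EP EM G p θ) {x y : LeafSpace EM p θ} (Γ : Path x y) :
    HomotopicToHorizontal Γ := by
  have : LocallyPathConnectedSpace unitInterval := (convex_Icc (0 : ℝ) 1).locallyPathConnectedSpace
  have : ContractibleSpace unitInterval :=
    (convex_Icc (0 : ℝ) 1).contractibleSpace ⟨0, by simp⟩
  -- The relation between `u` and `v` is transitive and holds locally in both directions, so it
  -- holds between `0` and `1`. The choice of `σ` is harmless because the interval is simply
  -- connected.
  have key := PreconnectedSpace.induction₂' (α := unitInterval)
    (fun u v => ∃ σ : Path u v, HomotopicToHorizontal (σ.map Γ.continuous)) ?_ ?_ 0 1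
  · obtain ⟨σ, hσ⟩ := key
    let ι : Path (0 : unitInterval) 1 := ⟨ContinuousMap.id _, rfl, rfl⟩
    exact (hσ.of_homotopic
      ((SimplyConnectedSpace.paths_homotopic σ ι).map Γ.toContinuousMap)).of_eq fun s => rfl
  · intro u
    obtain ⟨W, hW, h⟩ := LeafSpace.exists_nhds_homotopicToHorizontal hp hflat (Γ u)
    obtain ⟨V, ⟨hV, hVc⟩, hVW⟩ := (path_connected_basis u).mem_iff.1
      (Γ.continuous.continuousAt hW)
    filter_upwards [hV] with v hv
    obtain ⟨σ, hσ⟩ := hVc.joinedIn u (mem_of_mem_nhds hV) v hv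
    obtain ⟨σ', hσ'⟩ := hVc.joinedIn v hv u (mem_of_mem_nhds hV)
    exact ⟨⟨σ, h _ _ _ fun s => hVW (hσ s)⟩, ⟨σ', h _ _ _ fun s => hVW (hσ' s)⟩⟩
  · refine ⟨fun u v w => ?_⟩
    rintro ⟨σ, hσ⟩ ⟨σ', hσ'⟩
    exact ⟨σ.trans σ', by rw [Path.map_trans]; exact hσ.trans hσ'⟩

/-- The holonomy along a class of loops is its monodromy in the leaf space. -/
theorem hasHolonomy_iff [T2Space P] (hp : IsPrincipalBundle EG EP EM G p)
    (hflat : IsFlat EG EP EM G p θ) {m : M}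
    (e : (LeafSpace.proj : LeafSpace EM p θ → M) ⁻¹' {m}) (γ : FundamentalGroup M m) (g : G) :
    HasHolonomy p θ e.1.out γ g ↔
      haveI : IsManifold 𝓘(ℝ, EM) 1 M := IsManifold.of_le (n := ∞) (by simp)
      (LeafSpace.isQuotientCoveringMap hp hflat).fundamentalGroupToMulOpposite e γ =
        MulOpposite.op g := by
  have : IsManifold 𝓘(ℝ, EM) 1 M := IsManifold.of_le (n := ∞) (by simp)
  set hq := LeafSpace.isQuotientCoveringMap hp hflat
  have hgm : LeafSpace.proj (g • e.1) = m := (hq.map_smul g).trans e.2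
  rw [hq.fundamentalGroupToMulOpposite_apply_eq_Iff]
  constructor
  · rintro ⟨w, rfl, c, hc, hcw⟩
    let C : Path e.1 (g • e.1) :=
      { toFun := fun s => LeafSpace.mk EM p θ (c s)
        continuous_toFun := hc.continuous_mk hp.contMDiff_proj hflat
        source' := c.source
        target' := c.target }
    -- The horizontal lift, being continuous in the leaf space, is the lift that computes the
    -- monodromy.
    have := hq.isCoveringMap.monodromy_eq_of_map_eq (γ := .mk w) (ex := e) (ey := ⟨g • e.1, hgm⟩)
      (.mk C) ((congrArg Path.Homotopic.Quotient.mk (Path.ext (funext hcw))).trans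
        (Path.Homotopic.Quotient.mk_cast w e.2 hgm))
    exact (congrArg Subtype.val this).symm
  · intro h
    obtain ⟨w, rfl⟩ := Path.Homotopic.Quotient.mk_surjective γ
    have hlift := hq.isCoveringMap.map_liftPathQuotient (.mk w) e
    obtain ⟨Γ, hΓ⟩ := Path.Homotopic.Quotient.mk_surjective
      (hq.isCoveringMap.liftPathQuotient (.mk w) e)
    rw [← hΓ] at hlift
    -- Making the lift horizontal by a homotopy in the leaf space changes the loop below only within
    -- its class.
    obtain ⟨c, hc, hcΓ⟩ := homotopicToHorizontal hp.contMDiff_proj hflat Γ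
    rw [← Path.Homotopic.Quotient.eq.2 hcΓ] at hlift
    refine ⟨(c.map hq.continuous).cast e.2.symm (hq.isCoveringMap.monodromy (.mk w) e).2.symm, ?_,
      (c.map LeafSpace.continuous_out).cast rfl (congrArg LeafSpace.out h), hc, fun s => rfl⟩
    refine (Path.Homotopic.Quotient.mk_cast _ _ _).trans ?_
    refine (congrArg (fun q => Path.Homotopic.Quotient.cast q _ _) hlift).trans ?_
    exact (Path.Homotopic.Quotient.cast_cast _ _ _ _ _).trans
      (Path.Homotopic.Quotient.cast_rfl_rfl _)

end HorizontalHomotopy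

/-! ### Trivializations of the induced connection and lifts of `q` -/

section Induced

variable {EG EP EM EX : Type*}
  [NormedAddCommGroup EG] [NormedSpace ℝ EG]
  [NormedAddCommGroup EP] [NormedSpace ℝ EP]
  [NormedAddCommGroup EM] [NormedSpace ℝ EM]
  [NormedAddCommGroup EX] [NormedSpace ℝ EX]
  {G : Type*} [TopologicalSpace G] [ChartedSpace EG G] [Group G]
  {P : Type*} [TopologicalSpace P] [ChartedSpace EP P] [MulAction G P]
  {M : Type*} [TopologicalSpace M] [ChartedSpace EM M]
  {N : Type*} [TopologicalSpace N] [ChartedSpace EM N]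
  {X HX : Type*} [TopologicalSpace HX] {IX : ModelWithCorners ℝ EX HX}
  [TopologicalSpace X] [ChartedSpace HX X]
  {p : P → M} {q : C(N, M)}
  {hp : IsPrincipalBundle EG EP EM G p} {hq : IsRegularCovering EM q}

namespace InducedBundle

theorem coe_extChartAt (z : InducedBundle hp hq) :
    ⇑(extChartAt 𝓘(ℝ, EP) z) = extChartAt 𝓘(ℝ, EP) z.toTotal ∘ toTotal := by
  have h := (isLocalHomeomorph_toTotal hp hq z).choose_spec.2
  change chartAt EP z.toTotal ∘ (isLocalHomeomorph_toTotal hp hq z).choose = _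
  rw [← h]
  rfl

theorem continuous_proj : Continuous (proj : InducedBundle hp hq → N) :=
  continuous_fst.comp (continuous_toProd hp hq)

/-- Charts of the induced bundle factor through `toTotal`, so only that component has to be smooth.
The other enters through the topology, which comes from `N × P`. -/
theorem contMDiffAt_iff [IsManifold 𝓘(ℝ, EP) ∞ P] [IsManifold IX ∞ X]
    {f : X → InducedBundle hp hq} {x : X} :
    ContMDiffAt IX 𝓘(ℝ, EP) ∞ f x ↔
      ContinuousAt (fun y => (f y).proj) x ∧
        ContMDiffAt IX 𝓘(ℝ, EP) ∞ (fun y => (f y).toTotal) x := by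
  have hind : IsInducing (toProd : InducedBundle hp hq → N × P) := ⟨rfl⟩
  rw [contMDiffAt_iff_target, contMDiffAt_iff_target (f := fun y => (f y).toTotal),
    hind.continuousAt_iff, coe_extChartAt]
  refine ⟨fun ⟨h1, h2⟩ => ⟨h1.fst, h1.snd, h2⟩, fun ⟨h1, h2, h3⟩ => ⟨h1.prodMk h2, h3⟩⟩

variable [IsManifold 𝓘(ℝ, EP) ∞ P]

theorem contMDiff_toTotal :
    ContMDiff 𝓘(ℝ, EP) 𝓘(ℝ, EP) ∞ (toTotal : InducedBundle hp hq → P) := fun z =>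
  (contMDiffAt_iff.1 (contMDiffAt_id (x := z))).2

/-- Locally the projection is `p ∘ toTotal` followed by a smooth local inverse of `q`. -/
theorem contMDiff_proj :
    ContMDiff 𝓘(ℝ, EP) 𝓘(ℝ, EM) ∞ (proj : InducedBundle hp hq → N) := fun z => by
  obtain ⟨D, hD, hqD⟩ := hq.isLocalDiffeomorph z.proj
  have hD' : p z.toTotal ∈ D.target := by
    rw [← z.comm, hqD hD]; exact D.map_source hD
  have h1 : ContMDiffAt 𝓘(ℝ, EP) 𝓘(ℝ, EM) ∞
      (fun y : InducedBundle hp hq => D.symm (p y.toTotal)) z :=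
    (D.contMDiffOn_invFun.contMDiffAt (D.open_target.mem_nhds hD')).comp z
      (hp.contMDiff_proj.contMDiffAt.comp z contMDiff_toTotal.contMDiffAt)
  refine h1.congr_of_eventuallyEq ?_
  filter_upwards [continuous_proj.continuousAt (D.open_source.mem_nhds hD)] with y hy
  rw [← y.comm, hqD hy]
  exact (D.left_inv hy).symm

theorem inducedForm_mfderiv (θ : LieForm EG EP G P) {f : X → InducedBundle hp hq} {x : X}
    (hf : MDifferentiableAt IX 𝓘(ℝ, EP) f x) (v : TangentSpace IX x) :
    inducedForm hp hq θ (f x) (mfderiv IX 𝓘(ℝ, EP) f x v) =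
      θ (f x).toTotal (mfderiv IX 𝓘(ℝ, EP) (fun y => (f y).toTotal) x v) := by
  have h1 : mfderiv IX 𝓘(ℝ, EP) (fun y => (f y).toTotal) x =
      (mfderiv 𝓘(ℝ, EP) 𝓘(ℝ, EP) toTotal (f x)).comp (mfderiv IX 𝓘(ℝ, EP) f x) :=
    mfderiv_comp x (contMDiff_toTotal.mdifferentiable (by simp) _) hf
  rw [h1]
  rfl

end InducedBundle

variable {θ : LieForm EG EP G P}
  [LieGroup 𝓘(ℝ, EG) ∞ G] [IsManifold 𝓘(ℝ, EP) ∞ P]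
  [IsManifold 𝓘(ℝ, EM) ∞ N]

open InducedBundle

/-- A trivialization of the induced connection yields a lift of `q` to the leaf space through any
given point. -/
theorem IsTrivialConnection.exists_lift (hflat : IsFlat EG EP EM G p θ)
    (h : IsTrivialConnection EG EP EM G (InducedBundle.proj (hp := hp) (hq := hq))
      (InducedBundle.inducedForm hp hq θ)) (z : InducedBundle hp hq) :
    ∃ σ : C(N, LeafSpace EM p θ), (σ z.proj).out = z.toTotal ∧ ∀ n, (σ n).proj = q n := by
  have : IsManifold 𝓘(ℝ, EM) 1 N := IsManifold.of_le (n := ∞) (by simp)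
  obtain ⟨Ψ, h1, h2⟩ := h
  have hΨ : IsFlatTrivialization (InducedBundle.proj (hp := hp) (hq := hq))
    (InducedBundle.inducedForm hp hq θ) univ Ψ := ⟨h1, h2⟩
  -- The slice of coordinate `a` is the horizontal section through `z`.
  set a := hΨ.coord z
  have hF : ∀ n, p (Ψ (a, n)).toTotal = q n := fun n => by
    rw [← (Ψ (a, n)).comm, hΨ.proj_apply a n (mem_univ n)]
  have hd : ∀ n, MDifferentiableAt 𝓘(ℝ, EM) 𝓘(ℝ, EP) (fun n => (Ψ (a, n)).toTotal) n ∧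
      ∀ v, θ (Ψ (a, n)).toTotal
        (mfderiv 𝓘(ℝ, EM) 𝓘(ℝ, EP) (fun n => (Ψ (a, n)).toTotal) n v) = 0 := fun n => by
    have h3 := hΨ.form_section a (mem_univ n)
    refine ⟨(contMDiff_toTotal.mdifferentiable (by simp) _).comp n h3.1, fun v => ?_⟩
    rw [← inducedForm_mfderiv (f := fun n => Ψ (a, n)) θ h3.1 v]
    exact h3.2 v
  refine ⟨⟨fun n => LeafSpace.mk EM p θ (Ψ (a, n)).toTotal,
    continuous_iff_continuousAt.2 fun n => ?_⟩, ?_, hF⟩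
  · obtain ⟨U, Φ, hm, hΦ⟩ := hflat.exists_isFlatTrivialization (q n)
    have hm' : p (Ψ (a, n)).toTotal ∈ U := by rwa [hF]
    refine LeafSpace.tendsto_mk hΦ hm' (hΦ.eventually_coord_eq (EX := EM) hp.contMDiff_proj
      (f := fun n => (Ψ (a, n)).toTotal) hm' (Filter.Eventually.of_forall hd)) ?_
    simp only [hF]
    exact q.continuous.continuousAt
  · exact congrArg toTotal (hΨ.apply_coord (mem_univ z.proj))

variable [IsManifold 𝓘(ℝ, EM) ∞ M]

/-- A lift of `q` to the leaf space yields a trivialization of the induced connection. -/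
theorem isTrivialConnection_of_lift (hflat : IsFlat EG EP EM G p θ)
    (σ : C(N, LeafSpace EM p θ)) (hσ : ∀ n, (σ n).proj = q n) :
    IsTrivialConnection EG EP EM G (InducedBundle.proj (hp := hp) (hq := hq))
      (InducedBundle.inducedForm hp hq θ) := by
  have : IsManifold 𝓘(ℝ, EM) 1 M := IsManifold.of_le (n := ∞) (by simp)
  have hqc := LeafSpace.isQuotientCoveringMap hp hflat
  have hcancel := hqc.isCancelSMul
  -- The coordinate `κ z` is the group element carrying the lift to `z`; it is unique because the
  -- action is free, so `κ` with the projection inverts `s` below.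
  have hκ' : ∀ z : InducedBundle hp hq, ∃ a : G, a • (σ z.proj).out = z.toTotal := fun z =>
    hqc.apply_eq_iff_mem_orbit (e₁ := LeafSpace.mk EM p θ z.toTotal) (e₂ := σ z.proj).1
      (z.comm.symm.trans (hσ z.proj).symm)
  choose κ hκ using hκ'
  let s : G × N → InducedBundle hp hq := fun y =>
    ⟨y.2, y.1 • (σ y.2).out, by rw [hp.proj_smul]; exact (hσ y.2).symm⟩
  have hκs : ∀ y, κ (s y) = y.1 := fun y =>
    hcancel.right_cancel' (κ (s y)) y.1 (σ y.2) (hκ (s y))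
  -- A continuous lift stays locally on one plaque, of coordinate `b`. Read in `Φ`, the map `s` is
  -- then `(a, n) ↦ (a * b, q n)`, which is smooth.
  have hloc : ∀ n : N, ∃ (U : Set M)
      (Φ : PartialDiffeomorph (𝓘(ℝ, EG).prod 𝓘(ℝ, EM)) 𝓘(ℝ, EP) (G × M) P ∞)
      (hΦ : IsFlatTrivialization p θ U Φ) (b : G), q n ∈ U ∧
      ∀ᶠ n' in 𝓝 n, q n' ∈ U ∧ hΦ.coord (σ n').out = b := fun n => by
    obtain ⟨U, Φ, hm, hΦ⟩ := hflat.exists_isFlatTrivialization (q n)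
    refine ⟨U, Φ, hΦ, hΦ.coord (σ n).out, hm, ?_⟩
    filter_upwards [LeafSpace.eventually_coord_eq hp.contMDiff_proj hΦ
      (by rw [← hσ n] at hm; exact hm) σ.continuous.continuousAt] with n' hn'
    exact ⟨by rw [← hσ n']; exact hn'.1, hn'.2⟩
  have hsnd : ∀ y : G × N, Filter.Tendsto Prod.snd (𝓝 y) (𝓝 y.2) := fun y =>
    continuous_snd.continuousAt
  have hA : ∀ b : G, ContMDiff (𝓘(ℝ, EG).prod 𝓘(ℝ, EM)) (𝓘(ℝ, EG).prod 𝓘(ℝ, EM)) ∞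
      (fun y : G × N => (y.1 * b, q y.2)) := fun b =>
    (contMDiff_fst.mul contMDiff_const).prodMk (hq.isLocalDiffeomorph.contMDiff.comp contMDiff_snd)
  have hlocal : ∀ {n : N} {U : Set M}
      {Φ : PartialDiffeomorph (𝓘(ℝ, EG).prod 𝓘(ℝ, EM)) 𝓘(ℝ, EP) (G × M) P ∞}
      (hΦ : IsFlatTrivialization p θ U Φ) {b : G} (a : G), q n ∈ U →
      hΦ.coord (σ n).out = b → (s (a, n)).toTotal = Φ (a * b, q n) := by
    rintro n U Φ hΦ _ a hn rfl
    change a • (σ n).out = _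
    rw [hΦ.equivariant a _ _ hn]
    have hn' : p (σ n).out ∈ U := by change (σ n).proj ∈ U; rwa [hσ]
    conv_lhs => rw [← hΦ.apply_coord hn']
    rw [show p (σ n).out = q n from hσ n]
  have hs : ContMDiff (𝓘(ℝ, EG).prod 𝓘(ℝ, EM)) 𝓘(ℝ, EP) ∞ s := fun y => by
    obtain ⟨U, Φ, hΦ, b, hn, hev⟩ := hloc y.2
    refine contMDiffAt_iff.2 ⟨continuous_snd.continuousAt, ?_⟩
    have h1 : ContMDiffAt (𝓘(ℝ, EG).prod 𝓘(ℝ, EM)) 𝓘(ℝ, EP) ∞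
        (fun y : G × N => Φ (y.1 * b, q y.2)) y :=
      (Φ.contMDiffOn_toFun.contMDiffAt
        (Φ.open_source.mem_nhds (hΦ.mem_source (y.1 * b) hn))).comp y (hA b).contMDiffAt
    refine h1.congr_of_eventuallyEq ?_
    filter_upwards [(hsnd y).eventually hev] with y' hy'
    exact hlocal hΦ y'.1 hy'.1 hy'.2
  have hκsmooth : ContMDiff 𝓘(ℝ, EP) 𝓘(ℝ, EG) ∞ κ := fun z => by
    obtain ⟨U, Φ, hΦ, b, hn, hev⟩ := hloc z.proj
    have hz : p z.toTotal ∈ U := by rwa [← z.comm]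
    have h1 : ContMDiffAt 𝓘(ℝ, EP) 𝓘(ℝ, EG) ∞
        (fun y : InducedBundle hp hq => (Φ.symm y.toTotal).1 * b⁻¹) z :=
      (contMDiffAt_fst.comp z ((Φ.contMDiffOn_invFun.contMDiffAt
        (Φ.open_target.mem_nhds (hΦ.mem_target hz))).comp z
          contMDiff_toTotal.contMDiffAt)).mul contMDiffAt_const
    refine h1.congr_of_eventuallyEq ?_
    filter_upwards [(continuous_proj.tendsto z).eventually hev] with z' hz'
    have h2 := hlocal hΦ (κ z') hz'.1 hz'.2
    have h3 : (s (κ z', z'.proj)).toTotal = z'.toTotal := hκ z'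
    rw [h3] at h2
    change κ z' = hΦ.coord z'.toTotal * b⁻¹
    rw [h2, hΦ.coord_apply _ hz'.1, mul_inv_cancel_right]
  let Ψ : PartialDiffeomorph (𝓘(ℝ, EG).prod 𝓘(ℝ, EM)) 𝓘(ℝ, EP) (G × N) (InducedBundle hp hq) ∞ :=
    { toFun := s
      invFun := fun z => (κ z, z.proj)
      source := univ
      target := univ
      map_source' := fun _ _ => mem_univ _
      map_target' := fun _ _ => mem_univ _
      left_inv' := fun y _ => Prod.ext (hκs y) rfl
      right_inv' := fun z _ => InducedBundle.ext rfl (hκ z)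
      open_source := isOpen_univ
      open_target := isOpen_univ
      contMDiffOn_toFun := hs.contMDiffOn
      contMDiffOn_invFun := (hκsmooth.prodMk contMDiff_proj).contMDiffOn }
  refine ⟨Ψ, ⟨by simp [Ψ], by simp [Ψ], fun a n _ => rfl,
    fun g a n _ => InducedBundle.ext rfl (mul_smul g a _)⟩, fun a n _ v => ?_⟩
  change inducedForm hp hq θ (s (a, n)) (mfderiv _ _ s (a, n) v) = _
  rw [inducedForm_mfderiv θ (hs.mdifferentiable (by simp) _) v]
  obtain ⟨U, Φ, hΦ, b, hn, hev⟩ := hloc n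
  have h1 : (fun y => (s y).toTotal) =ᶠ[𝓝 (a, n)] Φ ∘ fun y : G × N => (y.1 * b, q y.2) := by
    filter_upwards [(hsnd (a, n)).eventually hev] with y' hy'
    exact hlocal hΦ y'.1 hy'.1 hy'.2
  have hΦd : MDifferentiableAt (𝓘(ℝ, EG).prod 𝓘(ℝ, EM)) 𝓘(ℝ, EP) Φ (a * b, q n) :=
    Φ.mdifferentiableAt (by simp) (hΦ.mem_source _ hn)
  have hAd := (hA b).mdifferentiable (by simp) (a, n)
  rw [h1.mfderiv_eq, mfderiv_comp (a, n) hΦd hAd]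
  refine (hΦ.form_mfderiv (z := (a * b, q n)) hn h1.self_of_nhds.symm _).trans ?_
  have hmul : ContMDiff 𝓘(ℝ, EG) 𝓘(ℝ, EG) ∞ (fun g : G => g * (a * b)⁻¹) := contMDiff_mul_right
  have hmulz : MDifferentiableAt (𝓘(ℝ, EG).prod 𝓘(ℝ, EM)) 𝓘(ℝ, EG)
      (fun y : G × M => y.1 * (a * b)⁻¹) (a * b, q n) :=
    (hmul.mdifferentiable (by simp) _).comp (a * b, q n) mdifferentiableAt_fst
  -- Right invariance of the canonical form absorbs `b`.
  have h2 : (fun y : G × N => y.1 * a⁻¹) =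
      (fun y : G × M => y.1 * (a * b)⁻¹) ∘ fun y : G × N => (y.1 * b, q y.2) := by
    ext y
    simp [mul_assoc]
  change _ = mfderiv (𝓘(ℝ, EG).prod 𝓘(ℝ, EM)) 𝓘(ℝ, EG) (fun y : G × N => y.1 * a⁻¹) (a, n) v
  rw [h2, mfderiv_comp (a, n) hmulz hAd]
  rfl

end Induced

/-! ### The lifting criterion and the monodromy homomorphism -/

section Holonomy

variable {E X N G : Type*} [TopologicalSpace E] [TopologicalSpace X] [TopologicalSpace N]
  [Group G] [MulAction G E] {π : E → X}

/-- The lifting criterion for a quotient covering map in terms of its monodromy. -/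
theorem exists_lift_iff_range_le_ker [PathConnectedSpace N] [LocallyPathConnectedSpace N]
    (hπ : IsQuotientCoveringMap π G) (q : C(N, X)) (n₀ : N) (e : π ⁻¹' {q n₀}) :
    (∃ σ : C(N, E), σ n₀ = e ∧ ∀ n, π (σ n) = q n) ↔
      (FundamentalGroup.map q n₀).range ≤ (hπ.fundamentalGroupToMulOpposite e).ker := by
  -- Monodromy commutes with `G`, which is transitive on the fibre, so a loop fixing `e` fixes the
  -- whole fibre. The kernel is thus the image of `π₁(E, e)`.
  rw [hπ.ker_fundamentalGroupToMulOpposite, hπ.ker_monodromyPerm e]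
  constructor
  · rintro ⟨σ, hσ, hq⟩ _ ⟨γ, rfl⟩
    obtain ⟨w, rfl⟩ := Path.Homotopic.Quotient.mk_surjective γ
    refine ⟨.mk ((w.map σ.continuous).cast hσ.symm hσ.symm), ?_⟩
    refine (FundamentalGroup.mapOfEq_apply (⟨π, hπ.continuous⟩ : C(E, X)) e.2 _).trans ?_
    exact congrArg Path.Homotopic.Quotient.mk (Path.ext (funext fun s => hq (w s)))
  · intro h
    obtain ⟨σ, ⟨h1, h2⟩, -⟩ :=
      hπ.isCoveringMap.existsUnique_continuousMap_lifts_of_range_le (f := q) e.2 h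
    exact ⟨σ, h1, congrFun h2⟩

/-- The homomorphism `h` such that lifts of loops in the class `γ` lead from `e` to `h γ • e`. -/
noncomputable def monodromyHom (hπ : IsQuotientCoveringMap π G) {x : X} (e : π ⁻¹' {x}) :
    (FundamentalGroup X x)ᵐᵒᵖ →* G :=
  (MulEquiv.opOp G).symm.toMonoidHom.comp (MonoidHom.op (hπ.fundamentalGroupToMulOpposite e))

theorem monodromyHom_op_eq_iff (hπ : IsQuotientCoveringMap π G) {x : X} (e : π ⁻¹' {x})
    (γ : FundamentalGroup X x) (g : G) :
    monodromyHom hπ e (MulOpposite.op γ) = g ↔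
      hπ.fundamentalGroupToMulOpposite e γ = MulOpposite.op g :=
  ⟨fun h => MulOpposite.unop_injective h, fun h => congrArg MulOpposite.unop h⟩

theorem op_le_ker_monodromyHom_iff (hπ : IsQuotientCoveringMap π G) {x : X} (e : π ⁻¹' {x})
    (H : Subgroup (FundamentalGroup X x)) :
    H.op ≤ (monodromyHom hπ e).ker ↔ H ≤ (hπ.fundamentalGroupToMulOpposite e).ker :=
  ⟨fun h γ hγ => (monodromyHom_op_eq_iff hπ e γ 1).1 (h (x := MulOpposite.op γ) hγ),
    fun h γ hγ => (monodromyHom_op_eq_iff hπ e γ.unop 1).2 (h hγ)⟩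

end Holonomy

end FlatBundle

theorem corollary0p2
    {EG EP EM : Type*}
    [NormedAddCommGroup EG] [NormedSpace ℝ EG] [FiniteDimensional ℝ EG]
    [NormedAddCommGroup EP] [NormedSpace ℝ EP] [FiniteDimensional ℝ EP]
    [NormedAddCommGroup EM] [NormedSpace ℝ EM] [FiniteDimensional ℝ EM]
    -- the Lie group
    {G : Type*} [TopologicalSpace G] [ChartedSpace EG G] [Group G] [LieGroup 𝓘(ℝ, EG) ∞ G]
    -- the total space and the base
    {P : Type*} [TopologicalSpace P] [ChartedSpace EP P] [IsManifold 𝓘(ℝ, EP) ∞ P]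
    [T2Space P] [ParacompactSpace P] [ConnectedSpace P] [MulAction G P]
    {M : Type*} [TopologicalSpace M] [ChartedSpace EM M] [IsManifold 𝓘(ℝ, EM) ∞ M]
    [T2Space M] [ParacompactSpace M] [ConnectedSpace M]
    -- the covering manifold
    {N : Type*} [TopologicalSpace N] [ChartedSpace EM N] [IsManifold 𝓘(ℝ, EM) ∞ N]
    [ConnectedSpace N]
    (p : P → M) (hp : FlatBundle.IsPrincipalBundle EG EP EM G p)
    (q : C(N, M)) (hq : FlatBundle.IsRegularCovering EM q)
    (θ : FlatBundle.LieForm EG EP G P)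
    (hθ : FlatBundle.IsConnectionForm EG EP G θ)
    (hflat : FlatBundle.IsFlat EG EP EM G p θ)
    -- the base points
    (n₀ : N) (x₀ : P) (hx₀ : p x₀ = q n₀) :
    ∃ h : (FundamentalGroup M (q n₀))ᵐᵒᵖ →* G,
      FlatBundle.IsHolonomyHom p θ x₀ h ∧
      (FlatBundle.IsTrivialConnection EG EP EM G (FlatBundle.InducedBundle.proj (hp := hp) (hq := hq))
          (FlatBundle.InducedBundle.inducedForm hp hq θ) ↔
        (FundamentalGroup.map q n₀).range.op ≤ h.ker) := by

  have : IsManifold 𝓘(ℝ, EM) 1 M := IsManifold.of_le (n := ∞) (by simp)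
  -- The lifting criterion requires `N` to be path connected and locally so.
  have : LocallyPathConnectedSpace N := ChartedSpace.locallyPathConnectedSpace EM N
  have : PathConnectedSpace N := pathConnectedSpace_iff_connectedSpace.2 inferInstance
  have hqc := FlatBundle.LeafSpace.isQuotientCoveringMap hp hflat
  let e : (FlatBundle.LeafSpace.proj : FlatBundle.LeafSpace EM p θ → M) ⁻¹' {q n₀} :=
    ⟨FlatBundle.LeafSpace.mk EM p θ x₀, hx₀⟩
  refine ⟨FlatBundle.monodromyHom hqc e, fun γ g => ?_, ?_⟩
  · rw [FlatBundle.monodromyHom_op_eq_iff]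
    exact FlatBundle.hasHolonomy_iff hp hflat e γ g
  · rw [FlatBundle.op_le_ker_monodromyHom_iff, ← FlatBundle.exists_lift_iff_range_le_ker hqc q n₀ e]
    constructor
    · intro h
      exact h.exists_lift hflat ⟨n₀, x₀, hx₀.symm⟩
    · rintro ⟨σ, -, hσ⟩
      exact FlatBundle.isTrivialConnection_of_lift hflat σ hσ
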